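/- Let $e_1=(1,0)$, $e_2=(0,1)$ and let $F,f:\mathbb R\to\mathbb R^2$ be given by $F(\rho)=0$ for $\rho\le 1$, $F(\rho)=(1-\rho)e_1$ for $1\le\rho\le2$, $F(\rho)=(\rho-3)e_1$ for $2\le\rho\le3$, $F(\rho)=(\rho-3)e_2$ for $\rho\ge3$, and $f(\rho)=0$ for $\rho\le1$, $f(\rho)=\rho^{-1}F(\rho)$ for $\rho\ge 1$. Then $F$ is Lipschitz continuous and $F(\rho)=f(\rho)\rho$. Consider, for $u=u(t,x)\in\mathbb R^2$, $x\in\mathbb R^2$, the Cauchy problem $$\partial_t u_i+\sum_{\alpha=1}^2\partial_{x_\alpha}\big(f_\alpha(|u|)\,u_i\big)=0\quad(i=1,2),\qquad u(0,x)=\bar u(x).\tag{1}$$ For $k\ge0$ let $$Q^\sharp_k=2^{-k}\bigcup_{j\in\mathbb Z}[2j,2j+1)\times[28-2j,31-2j),\qquad Q^\flat_k=2^{-k}\bigcup_{j\in\mathbb Z}[22-2j,25-2j)\times[2j+\tfrac12,2j+\tfrac32),$$ $$\widetilde Q^\sharp_k=2^{-k}\bigcup_{j\in\mathbb Z}[2j,2j+1)\times[17-2j,\tfrac{37}2-2j),$$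 and define $\rho_n(t,x)=4$ if $x-te_2\in\bigcup_{0\le k\le n}(Q^\sharp_k\cup\widetilde Q^\sharp_k)$; otherwise $\rho_n(t,x)=2$ if $x-te_1\in\bigcup_{0\le k\le n}Q^\flat_k$; otherwise $\rho_n(t,x)=3$. Fix $\beta\in(0,\pi/2)$ and set $$\bar u_n(x)=\rho_n(0,x)\big(\cos\bar\theta(x),\sin\bar\theta(x)\big),\qquad \bar\theta(x)=\beta\text{ if }\lfloor x_2\rfloor\text{ is even},\quad \bar\theta(x)=-\beta\text{ if }\lfloor x_2\rfloor\text{ is odd}.$$ Then: 1. The $\bar u_n$ are measurable, satisfy $2\le|\bar u_n|\le4$, and converge in $L^1_{loc}(\mathbb R^2)$ to a measurable $\bar u$ with $2\le|\bar u|\le 4$ a.e. 2. For every $n$, $\rho_n$ is a bounded entropy (Kruzhkov) solution of $\rho_t+\nabla_x\cdot F(\rho)=0$ with $\rho(0,\cdot)=|\bar u_n|$. The O.D.E. $\dot x=f(\rho_n(t,x))$, $x(0)=y$, has exactly one Carathéodory solution $t\mapsto\Phi_ty$ on $[0,\infty)$ for a.e. $y$; for every $t\ge0$ the map $\Phi_t$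 is invertible up to null sets, $\Phi_t$ and its inverse $\Phi^{-t}$ being measurable and such that preimages of null sets are null. There is a bounded measurable function $u_n$ with $$u_n(t,x)=\rho_n(t,x)\,\frac{\bar u_n}{|\bar u_n|}\big(\Phi^{-t}x\big)\quad\text{for every }t\ge0\text{ and a.e. }x,$$ which is a weak (distributional) solution of (1) with initial datum $\bar u_n$. 3. For every $n$ and $t\geq 0$, for a.e. $x$ with $32<x_1+x_2<t$, one has $u_n(t,x)=3(\cos\theta_n,\sin\theta_n)$ with $\theta_n=\beta$ if $\lfloor2^{n+1}x_2\rfloor$ is even and $\theta_n=-\beta$ if it is odd. 4. For every $t>32$ the sequence $u_n(t,\cdot)$ has no limit in $L^1_{loc}(\{x:32<x_1+x_2<t\})$, and the sequence $u_n$ has no limit in $L^1_{loc}(\{(t,x):32<x_1+x_2<t\})$; a fortiori there is no limit in $L^1_{loc}(\mathbb R^2)$, respectively in $L^1_{loc}((0,\infty)\times\mathbb R^2)$. 5. Hence (1) is ill posed for data that are measurable, bounded and bounded away from zero. Precisely: say that $u$ is a transport solution with datum $\bar u$ if it is a bounded weak solution of (1) obtained as in 2, i.e. from an entropy solution $\rho$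 of $\rho_t+\nabla_x\cdot(f(\rho)\rho)=0$, $\rho(0,\cdot)=|\bar u|$, whose O.D.E. $\dot x=f(\rho(t,x))$ has a flow with the properties in 2, by $u(t,x)=\rho(t,x)\frac{\bar u}{|\bar u|}(\Phi^{-t}x)$ for every $t\geq0$ and a.e. $x$. There is no map $S$ which assigns to every measurable $\bar u:\mathbb R^2\to\mathbb R^2$ with $a\le|\bar u|\le b$ a.e. for some $0<a\le b$ an element of $L^1_{loc}((0,\infty)\times\mathbb R^2;\mathbb R^2)$, is equal a.e. to every transport solution with datum $\bar u$, and is such that $\bar v_n\to\bar v$ in $L^1_{loc}(\mathbb R^2)$, with common bounds $0<a\le|\bar v_n|,|\bar v|\le b$ a.e., implies $S\bar v_n\to S\bar v$ in $L^1_{loc}((0,\infty)\times\mathbb R^2)$. -/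

import Mathlib

open MeasureTheory Filter Topology Set

noncomputable section

/-- Euclidean space `ℝ^m`. -/
abbrev Space (m : ℕ) : Type := EuclideanSpace ℝ (Fin m)

/-- Convergence `g n → h` in `L¹_loc(Ω)`: the integrals of `|g n - h|` over every compact
subset of `Ω` tend to zero. -/
def TendstoL1locOn {X E : Type*} [TopologicalSpace X] [MeasureSpace X] [NormedAddCommGroup E]
    (Ω : Set X) (g : ℕ → X → E) (h : X → E) : Prop :=
  ∀ K : Set X, K ⊆ Ω → IsCompact K →
    Tendsto (fun n => ∫⁻ x in K, ‖g n x - h x‖ₑ) atTop (𝓝 0)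

/-- The sequence `g` has a (strong) limit in `L¹_loc(Ω)`. -/
def HasL1locLimitOn {X E : Type*} [TopologicalSpace X] [MeasureSpace X] [NormedAddCommGroup E]
    (Ω : Set X) (g : ℕ → X → E) : Prop :=
  ∃ h : X → E, LocallyIntegrableOn h Ω ∧ TendstoL1locOn Ω g h

/-- Initial data that are measurable, bounded, and bounded away from zero:
`0 < a ≤ |ū(x)| ≤ b` for a.e. `x`. -/
structure IsAdmissibleDatum {m d : ℕ} (a b : ℝ) (uBar : Space m → Space d) : Prop where
  aestronglyMeasurable : AEStronglyMeasurable uBar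
  pos : 0 < a
  bounds : ∀ᵐ x, a ≤ ‖uBar x‖ ∧ ‖uBar x‖ ≤ b

/-- Test functions: `C^∞` with compact support in `ℝ × ℝ^m` (the support may meet `t = 0`). -/
structure IsTestFunction {m : ℕ} (φ : ℝ × Space m → ℝ) : Prop where
  smooth : ContDiff ℝ (⊤ : ℕ∞) φ
  compactSupport : HasCompactSupport φ

/-- The function `w` is (essentially) bounded and measurable on `(0,∞) × ℝ^m`. -/
structure IsBoundedMeasurable {m : ℕ} {E : Type*} [NormedAddCommGroup E]
    (w : ℝ → Space m → E) : Prop where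
  aestronglyMeasurable :
    AEStronglyMeasurable (fun p : ℝ × Space m => w p.1 p.2) (volume.restrict (Ioi 0 ×ˢ univ))
  bounded : ∃ M : ℝ, ∀ᵐ p : ℝ × Space m ∂(volume.restrict (Ioi 0 ×ˢ univ)), ‖w p.1 p.2‖ ≤ M

/-- Bounded weak solution of the Cauchy problem
`∂_t u_i + ∑_α ∂_{x_α} (f_α(|u|) u_i) = 0`, `u(0,·) = ū`.
Note that `fderiv ℝ φ (t, x) (1, v) = φ_t + v · ∇φ`; the identity is vector valued, i.e. it
holds for every component `u_i`. -/
structure IsWeakSolution {m d : ℕ} (f : ℝ → Space m) (uBar : Space m → Space d)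
    (u : ℝ → Space m → Space d) : Prop where
  bounded : IsBoundedMeasurable u
  weak : ∀ φ : ℝ × Space m → ℝ, IsTestFunction φ →
    (∫ t in Ioi (0 : ℝ), ∫ x, (fderiv ℝ φ (t, x) (1, f ‖u t x‖)) • u t x)
      + ∫ x, φ (0, x) • uBar x = 0

/-- Bounded entropy weak solution, in the sense of Kruzhkov, of the scalar Cauchy problem
`ρ_t + ∑_α ∂_{x_α} F_α(ρ) = 0`, `ρ(0,·) = ρ₀`: for all real constants `c` and all test functions
`φ ≥ 0`,
`∫_{t>0} ∫ (|ρ-c| φ_t + sign(ρ-c) (F(ρ)-F(c)) · ∇φ) dx dt + ∫ |ρ₀-c| φ(0,x) dx ≥ 0`. -/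
structure IsEntropySolution {m : ℕ} (F : ℝ → Space m) (ρ₀ : Space m → ℝ)
    (ρ : ℝ → Space m → ℝ) : Prop where
  bounded : IsBoundedMeasurable ρ
  entropy : ∀ (c : ℝ) (φ : ℝ × Space m → ℝ), IsTestFunction φ → (∀ p, 0 ≤ φ p) →
    0 ≤ (∫ t in Ioi (0 : ℝ), ∫ x,
          fderiv ℝ φ (t, x) (|ρ t x - c|, Real.sign (ρ t x - c) • (F (ρ t x) - F c)))
        + ∫ x, |ρ₀ x - c| * φ (0, x)

/-- `x` is a (Carathéodory) solution on `[0,∞)` of `ẋ = v(t,x)`, `x(0) = y`. -/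
def IsTrajectory {m : ℕ} (v : ℝ → Space m → Space m) (y : Space m) (x : ℝ → Space m) : Prop :=
  ∀ t, 0 ≤ t → IntervalIntegrable (fun s => v s (x s)) volume 0 t ∧
    x t = y + ∫ s in (0 : ℝ)..t, v s (x s)

/-- `Φ` is the flow of `ẋ = v(t,x)`: for almost every initial point the solution exists, is unique
and is given by `Φ`; moreover `Φ t` is invertible up to null sets, with inverse `Ψ t` (the map
`Φ^{-t}`), both maps being measurable and compatible with null sets. -/
structure IsFlow {m : ℕ} (v : ℝ → Space m → Space m) (Φ Ψ : ℝ → Space m → Space m) : Prop where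
  trajectory : ∀ᵐ y, IsTrajectory v y (fun t => Φ t y)
  unique : ∀ᵐ y, ∀ x : ℝ → Space m, IsTrajectory v y x → ∀ t, 0 ≤ t → x t = Φ t y
  forward : ∀ t, 0 ≤ t → Measure.QuasiMeasurePreserving (Φ t) volume volume
  backward : ∀ t, 0 ≤ t → Measure.QuasiMeasurePreserving (Ψ t) volume volume
  left_inv : ∀ t, 0 ≤ t → ∀ᵐ y, Ψ t (Φ t y) = y
  right_inv : ∀ t, 0 ≤ t → ∀ᵐ x, Φ t (Ψ t x) = x

/-- `u` is built from the datum `ū` as follows: `ρ` is an entropy solution of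
`ρ_t + ∑_α (f_α(ρ) ρ)_{x_α} = 0` with initial value `|ū|`, and the direction `ū/|ū|` is
transported along the flow of `ẋ = f(ρ(t,x))`, that is
`u(t,x) = ρ(t,x) · (ū/|ū|)(Φ^{-t} x)`. -/
structure IsTransportSolution {m d : ℕ} (f : ℝ → Space m) (uBar : Space m → Space d)
    (ρ : ℝ → Space m → ℝ) (u : ℝ → Space m → Space d) : Prop where
  entropy : IsEntropySolution (fun r => r • f r) (fun x => ‖uBar x‖) ρ
  transport : ∃ Φ Ψ : ℝ → Space m → Space m, IsFlow (fun t x => f (ρ t x)) Φ Ψ ∧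
    ∀ t, 0 ≤ t → ∀ᵐ x, u t x = ρ t x • (‖uBar (Ψ t x)‖⁻¹ • uBar (Ψ t x))

/-- Well-posedness in `L¹_loc` of the Cauchy problem for
`∂_t u_i + ∑_α ∂_{x_α} (f_α(|u|) u_i) = 0` with `u` valued in `ℝ^d`, for data that are bounded and
bounded away from zero: there is a solution operator `S` which returns the weak solution built by
transport whenever there is one, and which is continuous from `L¹_loc(ℝ^m)` to
`L¹_loc((0,∞) × ℝ^m)` along sequences of data satisfying uniform bounds. -/
def IsWellPosed {m : ℕ} (d : ℕ) (f : ℝ → Space m) : Prop :=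
  ∃ S : (Space m → Space d) → ℝ × Space m → Space d,
    (∀ (a b : ℝ) (uBar : Space m → Space d), IsAdmissibleDatum a b uBar →
      LocallyIntegrableOn (S uBar) (Ioi 0 ×ˢ univ)) ∧
    (∀ (a b : ℝ) (uBar : Space m → Space d) (ρ : ℝ → Space m → ℝ) (u : ℝ → Space m → Space d),
      IsAdmissibleDatum a b uBar → IsTransportSolution f uBar ρ u → IsWeakSolution f uBar u →
      ∀ᵐ p : ℝ × Space m ∂(volume.restrict (Ioi 0 ×ˢ univ)), S uBar p = u p.1 p.2) ∧
    (∀ (a b : ℝ) (uBar : ℕ → Space m → Space d) (uLim : Space m → Space d),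
      (∀ n, IsAdmissibleDatum a b (uBar n)) → IsAdmissibleDatum a b uLim →
      TendstoL1locOn univ uBar uLim →
      TendstoL1locOn (Ioi 0 ×ˢ univ) (fun n => S (uBar n)) (S uLim))

/-- The piecewise affine flux `F`. -/
def flux (ρ : ℝ) : Space 2 :=
  if ρ ≤ 1 then 0
  else if ρ ≤ 2 then !₂[1 - ρ, 0]
  else if ρ ≤ 3 then !₂[ρ - 3, 0]
  else !₂[0, ρ - 3]

/-- The velocity `f`, with `F(ρ) = f(ρ) ρ`. -/
def velocity (ρ : ℝ) : Space 2 :=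
  if ρ ≤ 1 then 0
  else if ρ ≤ 2 then !₂[ρ⁻¹ * (1 - ρ), 0]
  else if ρ ≤ 3 then !₂[ρ⁻¹ * (ρ - 3), 0]
  else !₂[0, ρ⁻¹ * (ρ - 3)]

/-- The array of rectangles of size `2^{-k} × 3·2^{-k}`, inside the strip
`x₁ + x₂ ∈ 2^{-k} [28, 32]` (coordinates are `x 0 = x₁`, `x 1 = x₂`). -/
def QSharp (k : ℕ) : Set (Space 2) :=
  {x | ∃ j : ℤ, (2 : ℝ) ^ k * x 0 ∈ Ico (2 * j : ℝ) (2 * j + 1) ∧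
    (2 : ℝ) ^ k * x 1 ∈ Ico (28 - 2 * j : ℝ) (31 - 2 * j)}

/-- The array of rectangles of size `3·2^{-k} × 2^{-k}`, inside the strip
`x₁ + x₂ ∈ 2^{-k} [22, 27]`. -/
def QFlat (k : ℕ) : Set (Space 2) :=
  {x | ∃ j : ℤ, (2 : ℝ) ^ k * x 0 ∈ Ico (22 - 2 * j : ℝ) (25 - 2 * j) ∧
    (2 : ℝ) ^ k * x 1 ∈ Ico (2 * j + 1 / 2 : ℝ) (2 * j + 3 / 2)}

/-- The array of rectangles of size `2^{-k} × 3·2^{-k-1}`, inside the strip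
`x₁ + x₂ ∈ 2^{-k} [16, 21]`. -/
def QTilde (k : ℕ) : Set (Space 2) :=
  {x | ∃ j : ℤ, (2 : ℝ) ^ k * x 0 ∈ Ico (2 * j : ℝ) (2 * j + 1) ∧
    (2 : ℝ) ^ k * x 1 ∈ Ico (17 - 2 * j : ℝ) (17 - 2 * j + 3 / 2)}

open Classical in
/-- The scalar solution `ρ_n`: value `4` on the rectangles moving upward with unit speed, value
`2` on the rectangles moving to the right with unit speed, and `3` elsewhere. -/
def rho (n : ℕ) (t : ℝ) (x : Space 2) : ℝ :=
  if ∃ k ≤ n, x - t • (!₂[0, 1] : Space 2) ∈ QSharp k ∪ QTilde k then 4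
  else if ∃ k ≤ n, x - t • (!₂[1, 0] : Space 2) ∈ QFlat k then 2
  else 3

/-- The angle equal to `β` where `⌊2^j x₂⌋` is even and to `-β` where it is odd. -/
def angle (β : ℝ) (j : ℕ) (x : Space 2) : ℝ :=
  if Even ⌊(2 : ℝ) ^ j * x 1⌋ then β else -β

/-- The unit vector `(cos θ, sin θ)`. -/
def unitVector (θ : ℝ) : Space 2 := !₂[Real.cos θ, Real.sin θ]

/-- The initial data `ū_n(x) = ρ_n(0,x) (cos θ̄(x), sin θ̄(x))`, where `θ̄ = ±β` according to the
parity of `⌊x₂⌋`. -/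
def initialDatum (β : ℝ) (n : ℕ) (x : Space 2) : Space 2 :=
  rho n 0 x • unitVector (angle β 0 x)

end

/-! In the variable σ = t - x₁ - x₂ the problem becomes elementary. A rectangle moving with unit
speed along an axis is given by its range of transverse coordinates and, for each of these, an
interval of σ. While σ lies in that interval a point slides along the axis, at rate 1/3 per unit of
σ where ρ = 4 and -1/3 where ρ = 2; elsewhere it rests, since f(3) = 0. Hence each array acts as a
shear. The σ-windows of different arrays are disjoint, so the trajectories are finite compositions
of shears (`ShearSystem.pos`), labelled by the position z before the first array.

Two computations give the PDE. First, (σ, z) ↦ (t, x) preserves Lebesgue measure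
(`ShearSystem.measurePreserving_event`) and dt/dσ = ρ/3 on trajectories, so ρ (φ_t + f·∇φ)
integrates along each trajectory to a boundary term: every bounded measurable function of the label
is weakly transported (`ShearSystem.integral_label_transport`). Second, F is affine on [2,3] and
[3,4] with slopes e₁ and e₂, which are the velocities of the rectangles; so all jumps of ρ are
contact discontinuities and every Kruzhkov entropy is conserved exactly
(`ShearSystem.integral_phases`). Comparing the two shows that 3 dz is pushed forward to ρ(t,·) dx
(`ShearSystem.map_place`), which yields the null-set properties of the flow and the initial
condition. Trajectories are unique because the label is constant along every Carathéodory solution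
(`ShearSystem.label_trajectory`).

The oscillation is combinatorial. In units of 2^{-k}, the three arrays of level k move even columns
up by 1, then even rows (offset by 1/2) left by 1, then even columns up by 1/2. This turns
horizontal stripes of width 1 into stripes of width 1/2 (`stripes_halved`), and the construction
iterates by scaling. Points with 32 < x₁ + x₂ < t have crossed all arrays, and at time 0 they were
still in the stripe of their label (`even_floor_place_zero`). Ever finer stripes have no strong
limit, whereas the data converge because the arrays of level k lie within distance O(2^{-k}) of the
line x₁ + x₂ = 0. A continuous solution operator would produce the missing limit. -/

noncomputable section

/-! ### Ramps, coordinate axes and the constants of the moving rectangles -/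

/-- The length of the part of `(c, d]` that lies to the left of `σ`. -/
def ramp (c d σ : ℝ) : ℝ := max 0 (min (σ - c) (d - c))

theorem ramp_of_le {c d σ : ℝ} (h : σ ≤ c) : ramp c d σ = 0 :=
  max_eq_left ((min_le_left _ _).trans (by linarith))

theorem ramp_of_ge {c d σ : ℝ} (hcd : c ≤ d) (h : d ≤ σ) : ramp c d σ = d - c := by
  rw [ramp, min_eq_right (by linarith), max_eq_right (by linarith)]

theorem ramp_of_mem {c d σ : ℝ} (h₁ : c ≤ σ) (h₂ : σ ≤ d) : ramp c d σ = σ - c := by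
  rw [ramp, min_eq_left (by linarith), max_eq_right (by linarith)]

theorem ramp_nonneg (c d σ : ℝ) : 0 ≤ ramp c d σ := le_max_left _ _

theorem continuous_ramp (c d : ℝ) : Continuous (ramp c d) := by
  unfold ramp; fun_prop

theorem hasDerivAt_ramp {c d σ : ℝ} (hcd : c ≤ d) (hc : σ ≠ c) (hd : σ ≠ d) :
    HasDerivAt (ramp c d) (indicator (Ioc c d) 1 σ) σ := by
  rcases lt_or_gt_of_ne hc with h | h
  · rw [indicator_of_notMem (fun h' => absurd h'.1 (not_lt.2 h.le))]
    exact (hasDerivAt_const σ (0 : ℝ)).congr_of_eventuallyEq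
      ((eventually_lt_nhds h).mono fun s hs => ramp_of_le hs.le)
  rcases lt_or_gt_of_ne hd with h' | h'
  · rw [indicator_of_mem (show σ ∈ Ioc c d from ⟨h, h'.le⟩)]
    exact ((hasDerivAt_id σ).sub_const c).congr_of_eventuallyEq
      (((eventually_gt_nhds h).and (eventually_lt_nhds h')).mono
        fun s hs => ramp_of_mem hs.1.le hs.2.le)
  · rw [indicator_of_notMem (fun h'' => absurd h''.2 (not_le.2 h'))]
    exact (hasDerivAt_const σ (d - c)).congr_of_eventuallyEq
      ((eventually_gt_nhds h').mono fun s hs => ramp_of_ge hcd hs.le)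

/-- The unit vector of the `a`-th axis. -/
abbrev axisVector (a : Fin 2) : Space 2 := EuclideanSpace.single a 1

theorem add_smul_axisVector_self (x : Space 2) (r : ℝ) (a : Fin 2) :
    (x + r • axisVector a) a = x a + r := by simp

theorem add_smul_axisVector_other (x : Space 2) (r : ℝ) (a : Fin 2) :
    (x + r • axisVector a) (1 - a) = x (1 - a) := by
  fin_cases a <;> simp

theorem sum_add_smul_axisVector (x : Space 2) (r : ℝ) (a : Fin 2) :
    (x + r • axisVector a) 0 + (x + r • axisVector a) 1 = x 0 + x 1 + r := by
  fin_cases a <;> simp <;> ring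

theorem sum_eq_axis (x : Space 2) (a : Fin 2) : x 0 + x 1 = x a + x (1 - a) := by
  fin_cases a <;> simp [add_comm]

theorem space_ext_axis {x y : Space 2} (a : Fin 2) (h : x a = y a) (h' : x (1 - a) = y (1 - a)) :
    x = y := by
  ext i
  fin_cases a <;> fin_cases i <;> simp_all

/-- The value of the density in the rectangles that move along the `a`-th axis. -/
def movingDensity (a : Fin 2) : ℝ := if a = 1 then 4 else 2

/-- The velocity, along the `a`-th axis, of the points in rectangles moving along this axis. -/
def movingSpeed (a : Fin 2) : ℝ := if a = 1 then 1 / 4 else -1 / 2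

/-- The displacement of a point per unit of `t - x₁ - x₂`. -/
def shearRate (a : Fin 2) : ℝ := if a = 1 then 1 / 3 else -1 / 3

theorem velocity_three : velocity 3 = 0 := by
  ext i
  fin_cases i <;> norm_num [velocity]

theorem velocity_movingDensity (a : Fin 2) :
    velocity (movingDensity a) = movingSpeed a • axisVector a := by
  ext i
  fin_cases a <;> fin_cases i <;> norm_num [velocity, movingDensity, movingSpeed]

/-- Along a trajectory of speed s one has dσ/dt = 1 - s, and ρ (1 - s) = 3 in every phase: the same
mass crosses every level of σ. Hence dt/dσ = ρ/3, and the displacement per unit of σ is s/(1 - s).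
-/
theorem shearRate_eq_density (a : Fin 2) : 1 + shearRate a = movingDensity a / 3 := by
  fin_cases a <;> norm_num [shearRate, movingDensity]

theorem shearRate_eq_speed (a : Fin 2) :
    shearRate a = movingDensity a / 3 * movingSpeed a := by
  fin_cases a <;> norm_num [shearRate, movingDensity, movingSpeed]

theorem shearRate_mul_one_sub (a : Fin 2) :
    shearRate a * (1 - movingSpeed a) = movingSpeed a := by
  fin_cases a <;> norm_num [shearRate, movingSpeed]

/-! ### Systems of shears in the variable σ -/

/-- A sequence of arrays of moving intervals. In the variable `σ = t - x₁ - x₂` the `m`-th array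
acts, on points with transverse coordinate `p`, while `σ ∈ (enter m p, exit m p]`, and it displaces
them along the axis `axis m`. Different arrays act in disjoint windows `[lo m, hi m]`. -/
structure ShearSystem where
  axis : ℕ → Fin 2
  enter : ℕ → ℝ → ℝ
  exit : ℕ → ℝ → ℝ
  lo : ℕ → ℝ
  hi : ℕ → ℝ
  measurable_enter : ∀ m, Measurable (enter m)
  measurable_exit : ∀ m, Measurable (exit m)
  enter_le_exit : ∀ m p, enter m p ≤ exit m p
  lo_le_enter : ∀ m p, lo m ≤ enter m p
  exit_le_hi : ∀ m p, exit m p ≤ hi m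
  hi_lt_lo : ∀ m, hi m < lo (m + 1)

namespace ShearSystem

variable (S : ShearSystem)

theorem lo_le_hi (m : ℕ) : S.lo m ≤ S.hi m :=
  ((S.lo_le_enter m 0).trans (S.enter_le_exit m 0)).trans (S.exit_le_hi m 0)

theorem lo_strictMono : StrictMono S.lo :=
  strictMono_nat_of_lt_succ fun m => (S.lo_le_hi m).trans_lt (S.hi_lt_lo m)

theorem hi_lt_lo_of_lt {l m : ℕ} (h : l < m) : S.hi l < S.lo m :=
  (S.hi_lt_lo l).trans_le (S.lo_strictMono.monotone h)

/-- The displacement caused by the `m`-th array up to `σ`. -/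
def shift (m : ℕ) (σ : ℝ) (x : Space 2) : ℝ :=
  shearRate (S.axis m) *
    ramp (S.enter m (x (1 - S.axis m))) (S.exit m (x (1 - S.axis m))) σ

/-- The displacement depends only on the transverse coordinate, which the displacement does not
alter; this makes each shear invertible with an explicit inverse. -/
theorem shift_add_smul (m : ℕ) (σ : ℝ) (x : Space 2) (r : ℝ) :
    S.shift m σ (x + r • axisVector (S.axis m)) = S.shift m σ x := by
  rw [shift, add_smul_axisVector_other, shift]

/-- The shear caused by the `m`-th array up to `σ`. -/
def shear (m : ℕ) (σ : ℝ) : Space 2 ≃ Space 2 where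
  toFun x := x + S.shift m σ x • axisVector (S.axis m)
  invFun x := x + (-S.shift m σ x) • axisVector (S.axis m)
  left_inv x := by
    simp only [shift_add_smul]
    simp
  right_inv x := by
    simp only [shift_add_smul]
    simp

theorem shear_apply (m : ℕ) (σ : ℝ) (x : Space 2) :
    S.shear m σ x = x + S.shift m σ x • axisVector (S.axis m) := rfl

theorem shear_symm_apply (m : ℕ) (σ : ℝ) (x : Space 2) :
    (S.shear m σ).symm x = x + (-S.shift m σ x) • axisVector (S.axis m) := rfl

theorem shear_of_le {m : ℕ} {σ : ℝ} (h : σ ≤ S.lo m) : S.shear m σ = Equiv.refl _ := by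
  ext1 x
  rw [shear_apply, shift, ramp_of_le (h.trans (S.lo_le_enter m _))]
  simp

theorem shear_of_ge {m : ℕ} {σ : ℝ} (h : S.hi m ≤ σ) : S.shear m σ = S.shear m (S.hi m) := by
  ext1 x
  rw [shear_apply, shift, ramp_of_ge (S.enter_le_exit m _) ((S.exit_le_hi m _).trans h),
    shear_apply, shift, ramp_of_ge (S.enter_le_exit m _) (S.exit_le_hi m _)]

/-- The position, when `t - x₁ - x₂ = σ`, of the point that starts at `z` (at `σ = -∞`) and moves
under the action of the first `N` arrays. -/
def pos : ℕ → ℝ → Space 2 ≃ Space 2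
  | 0, _ => Equiv.refl _
  | N + 1, σ => (pos N σ).trans (S.shear N σ)

/-- The total effect of the first `m` arrays. -/
def total : ℕ → Space 2 ≃ Space 2
  | 0 => Equiv.refl _
  | m + 1 => (total m).trans (S.shear m (S.hi m))

theorem total_succ (m : ℕ) (z : Space 2) :
    S.total (m + 1) z = S.shear m (S.hi m) (S.total m z) := rfl

theorem pos_eq_total {N : ℕ} {σ : ℝ} (h : ∀ l < N, S.hi l ≤ σ) : S.pos N σ = S.total N := by
  induction N with
  | zero => rfl
  | succ N ih =>
    rw [pos, total, ih fun l hl => h l (hl.trans N.lt_succ_self), S.shear_of_ge (h N N.lt_succ_self)]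

/-- In the values of `σ` satisfying this property, only the `m`-th of the first `N` arrays can
be active. -/
def OnlyAt (N m : ℕ) (σ : ℝ) : Prop :=
  (∀ l < m, S.hi l < σ) ∧ ∀ l < N, m < l → σ < S.lo l

/-- Earlier arrays have finished and later ones have not begun, so locally the motion is a single
shear applied to a fixed point. -/
theorem pos_eq_shear {N m : ℕ} {σ : ℝ} (hm : m < N) (h : S.OnlyAt N m σ) :
    S.pos N σ = (S.total m).trans (S.shear m σ) := by
  obtain ⟨k, rfl⟩ := Nat.exists_eq_add_of_lt hm
  induction k with
  | zero => rw [add_zero, pos, S.pos_eq_total fun l hl => (h.1 l hl).le]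
  | succ k ih =>
    rw [← add_assoc, pos, ih (by omega) ⟨h.1, fun l hl => h.2 l (by omega)⟩,
      S.shear_of_le (h.2 (m + k + 1) (by omega) (by omega)).le, Equiv.trans_refl]

/-- The windows are closed, disjoint and ordered. The index chosen is the last window already begun
(or the first, if none has); only strict inequalities are involved, so the choice persists nearby.
-/
theorem exists_onlyAt {N : ℕ} (hN : 0 < N) (σ : ℝ) :
    ∃ m < N, ∀ᶠ s in 𝓝 σ, S.OnlyAt N m s := by
  obtain ⟨m, hm, h₁, h₂⟩ : ∃ m < N, (∀ l < m, S.hi l < σ) ∧ ∀ l < N, m < l → σ < S.lo l := by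
    induction N with
    | zero => omega
    | succ N ih =>
      rcases Nat.eq_zero_or_pos N with rfl | hN'
      · exact ⟨0, by omega, by intros; omega, by intros; omega⟩
      by_cases h : σ < S.lo N
      · obtain ⟨m, hm, h₁, h₂⟩ := ih hN'
        refine ⟨m, by omega, h₁, fun l hl hml => ?_⟩
        rcases Nat.lt_succ_iff_lt_or_eq.1 hl with hl' | rfl
        exacts [h₂ l hl' hml, h]
      · exact ⟨N, by omega, fun l hl => (S.hi_lt_lo_of_lt hl).trans_le (not_lt.1 h),
          by intros; omega⟩
  refine ⟨m, hm, ((eventually_all_finite (finite_lt_nat m)).2 fun l hl =>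
    eventually_gt_nhds (h₁ l hl)).and ?_⟩
  refine ((eventually_all_finite (finite_lt_nat N)).2 fun l hl => ?_)
  by_cases hml : m < l
  · exact (eventually_lt_nhds (h₂ l hl hml)).mono fun s hs _ => hs
  · exact Eventually.of_forall fun s h => absurd h hml

/-- The `m`-th array acts on the point `x` at `t - x₁ - x₂ = σ`. -/
def IsActive (m : ℕ) (σ : ℝ) (x : Space 2) : Prop :=
  σ ∈ Ioc (S.enter m (x (1 - S.axis m))) (S.exit m (x (1 - S.axis m)))

theorem IsActive.not_of_onlyAt {S : ShearSystem} {N m l : ℕ} {σ : ℝ} {x : Space 2} (h : S.OnlyAt N m σ)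
    (hl : l < N) (hne : l ≠ m) : ¬ S.IsActive l σ x := by
  intro ha
  rcases lt_or_gt_of_ne hne with h' | h'
  · exact absurd (ha.2.trans (S.exit_le_hi l _)) (not_le.2 (h.1 l h'))
  · exact absurd ((S.lo_le_enter l _).trans_lt ha.1) (not_lt.2 (h.2 l hl h').le)

open Classical in
/-- The density: it differs from `3` where one of the first `N` arrays is active. -/
def density (N : ℕ) (σ : ℝ) (x : Space 2) : ℝ :=
  if ∃ m < N, S.axis m = 1 ∧ S.IsActive m σ x then 4
  else if ∃ m < N, S.axis m = 0 ∧ S.IsActive m σ x then 2 else 3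

open Classical in
theorem density_of_onlyAt {N m : ℕ} {σ : ℝ} (hm : m < N) (h : S.OnlyAt N m σ) (x : Space 2) :
    S.density N σ x = if S.IsActive m σ x then movingDensity (S.axis m) else 3 := by
  have key : ∀ a, (∃ l < N, S.axis l = a ∧ S.IsActive l σ x) ↔ S.axis m = a ∧ S.IsActive m σ x := by
    intro a
    refine ⟨fun ⟨l, hl, h1, h2⟩ => ?_, fun h' => ⟨m, hm, h'⟩⟩
    by_cases hlm : l = m
    · exact hlm ▸ ⟨h1, h2⟩
    · exact absurd h2 (IsActive.not_of_onlyAt h hl hlm)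
  rw [density, if_congr (key 1) rfl rfl, if_congr (key 0) rfl rfl]
  have : S.axis m = 0 ∨ S.axis m = 1 := by omega
  rcases this with h0 | h0 <;> by_cases ha : S.IsActive m σ x <;> simp [h0, ha, movingDensity]

theorem density_mem (N : ℕ) (σ : ℝ) (x : Space 2) :
    2 ≤ S.density N σ x ∧ S.density N σ x ≤ 4 := by
  unfold density
  split_ifs <;> norm_num

/-- The value of `t` at the point of the trajectory with label `z` where `t - x₁ - x₂ = σ`. -/
def time (N : ℕ) (z : Space 2) (σ : ℝ) : ℝ := σ + (S.pos N σ z 0 + S.pos N σ z 1)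

/-- These are the equations dx/dσ = (ρ/3) f(ρ) and dt/dσ = ρ/3, whose quotient is the O.D.E. They
come from differentiating one ramp, away from its two corners. -/
theorem hasDerivAt_pos_aux {N m : ℕ} (hm : m < N) {σ : ℝ} (h : ∀ᶠ s in 𝓝 σ, S.OnlyAt N m s)
    (z : Space 2) (hc : σ ≠ S.enter m (S.total m z (1 - S.axis m)))
    (hd : σ ≠ S.exit m (S.total m z (1 - S.axis m))) :
    HasDerivAt (fun s => S.pos N s z) ((S.density N σ (S.pos N σ z) / 3) •
      velocity (S.density N σ (S.pos N σ z))) σ ∧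
    HasDerivAt (S.time N z) (S.density N σ (S.pos N σ z) / 3) σ := by
  set a := S.axis m with ha
  set y := S.total m z with hy
  have hpos : ∀ᶠ s in 𝓝 σ, S.pos N s z = y + S.shift m s y • axisVector a :=
    h.mono fun s hs => by rw [S.pos_eq_shear hm hs]; rfl
  have htime : ∀ᶠ s in 𝓝 σ, S.time N z s = s + (y 0 + y 1 + S.shift m s y) :=
    hpos.mono fun s hs => by rw [time, hs, sum_add_smul_axisVector]
  have hr : HasDerivAt (fun s => S.shift m s y)
      (shearRate a * indicator (Ioc (S.enter m (y (1 - a))) (S.exit m (y (1 - a)))) 1 σ) σ :=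
    (hasDerivAt_ramp (S.enter_le_exit m _) hc hd).const_mul _
  have hact : S.IsActive m σ (S.pos N σ z) ↔
      σ ∈ Ioc (S.enter m (y (1 - a))) (S.exit m (y (1 - a))) := by
    rw [IsActive, hpos.self_of_nhds, ← ha, add_smul_axisVector_other]
  rw [S.density_of_onlyAt hm h.self_of_nhds]
  have h1 := ((hr.smul_const (axisVector a)).const_add y).congr_of_eventuallyEq hpos
  have h2 := ((hasDerivAt_id σ).add (hr.const_add (y 0 + y 1))).congr_of_eventuallyEq htime
  by_cases hσ : S.IsActive m σ (S.pos N σ z)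
  · rw [if_pos hσ]
    rw [indicator_of_mem (hact.1 hσ), Pi.one_apply, mul_one] at h1 h2
    rw [velocity_movingDensity, smul_smul, ← shearRate_eq_speed, ← shearRate_eq_density]
    exact ⟨h1, h2⟩
  · rw [if_neg hσ]
    rw [indicator_of_notMem (mt hact.2 hσ), mul_zero] at h1 h2
    rw [velocity_three, smul_zero]
    exact ⟨by simpa using h1, by simpa using h2⟩

/-- The values of `σ` where the trajectory with label `z` may have a corner. -/
def corners (N : ℕ) (z : Space 2) : Set ℝ :=
  ⋃ m < N, {S.enter m (S.total m z (1 - S.axis m)), S.exit m (S.total m z (1 - S.axis m))}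

theorem countable_corners (N : ℕ) (z : Space 2) : (S.corners N z).Countable :=
  ((finite_lt_nat N).biUnion fun _ _ => toFinite _).countable

variable {N : ℕ}

theorem hasDerivAt_pos_time (hN : 0 < N) (z : Space 2) {σ : ℝ} (hσ : σ ∉ S.corners N z) :
    HasDerivAt (fun s => S.pos N s z) ((S.density N σ (S.pos N σ z) / 3) •
      velocity (S.density N σ (S.pos N σ z))) σ ∧
    HasDerivAt (S.time N z) (S.density N σ (S.pos N σ z) / 3) σ := by
  obtain ⟨m, hm, h⟩ := S.exists_onlyAt hN σ
  have : ¬ (σ = _ ∨ σ = _) := fun h' => hσ (mem_biUnion (show m ∈ {m | m < N} from hm) h')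
  exact S.hasDerivAt_pos_aux hm h z (fun h' => this (Or.inl h')) (fun h' => this (Or.inr h'))

theorem continuous_shift (m : ℕ) (x : Space 2) : Continuous fun σ => S.shift m σ x :=
  continuous_const.mul (continuous_ramp _ _)

theorem continuous_pos (hN : 0 < N) (z : Space 2) : Continuous fun σ => S.pos N σ z := by
  rw [continuous_iff_continuousAt]
  intro σ
  obtain ⟨m, hm, h⟩ := S.exists_onlyAt hN σ
  have : Continuous fun s => S.total m z + S.shift m s (S.total m z) • axisVector (S.axis m) :=
    continuous_const.add ((S.continuous_shift m _).smul continuous_const)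
  exact this.continuousAt.congr_of_eventuallyEq
    (h.mono fun s hs => by simp only [S.pos_eq_shear hm hs]; rfl)

theorem continuous_time (hN : 0 < N) (z : Space 2) : Continuous (S.time N z) := by
  have h := S.continuous_pos hN z
  unfold time
  fun_prop

theorem measurable_shift (m : ℕ) : Measurable fun p : ℝ × Space 2 => S.shift m p.1 p.2 := by
  have h1 := S.measurable_enter m
  have h2 := S.measurable_exit m
  unfold shift ramp
  fun_prop

theorem measurable_shear (m : ℕ) : Measurable fun p : ℝ × Space 2 => S.shear m p.1 p.2 := by
  have := S.measurable_shift m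
  simp only [shear_apply]
  fun_prop

theorem measurable_shear_symm (m : ℕ) :
    Measurable fun p : ℝ × Space 2 => (S.shear m p.1).symm p.2 := by
  have := S.measurable_shift m
  simp only [shear_symm_apply]
  fun_prop

theorem measurable_pos (N : ℕ) : Measurable fun p : ℝ × Space 2 => S.pos N p.1 p.2 := by
  induction N with
  | zero => exact measurable_snd
  | succ N ih => exact (S.measurable_shear N).comp (measurable_fst.prodMk ih)

theorem measurable_pos_symm (N : ℕ) :
    Measurable fun p : ℝ × Space 2 => (S.pos N p.1).symm p.2 := by
  induction N with
  | zero => exact measurable_snd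
  | succ N ih => exact ih.comp (measurable_fst.prodMk (S.measurable_shear_symm N))

end ShearSystem

theorem measurable_velocity : Measurable velocity := by
  have h : ∀ g h : ℝ → ℝ, Measurable g → Measurable h →
      Measurable fun r => (!₂[g r, h r] : Space 2) := fun g h hg hh => by
    refine (WithLp.measurable_toLp 2 _).comp (measurable_pi_lambda _ fun i => ?_)
    fin_cases i
    exacts [hg, hh]
  unfold velocity
  refine Measurable.ite measurableSet_Iic measurable_const (Measurable.ite measurableSet_Iic
    (h _ _ ?_ ?_) (Measurable.ite measurableSet_Iic (h _ _ ?_ ?_) (h _ _ ?_ ?_))) <;> fun_prop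

/-! ### Trajectories parametrised by time: existence -/

namespace ShearSystem

variable (S : ShearSystem) {N : ℕ}

theorem measurableSet_isActive (m : ℕ) :
    MeasurableSet {p : ℝ × Space 2 | S.IsActive m p.1 p.2} := by
  have h1 := S.measurable_enter m
  have h2 := S.measurable_exit m
  have h3 : Measurable fun p : ℝ × Space 2 => p.2 (1 - S.axis m) := by fun_prop
  exact (measurableSet_lt (h1.comp h3) measurable_fst).inter
    (measurableSet_le measurable_fst (h2.comp h3))

theorem measurable_density (N : ℕ) : Measurable fun p : ℝ × Space 2 => S.density N p.1 p.2 := by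
  have h : ∀ a, MeasurableSet {p : ℝ × Space 2 | ∃ m < N, S.axis m = a ∧ S.IsActive m p.1 p.2} := by
    intro a
    simp only [ofPred_exists, ofPred_and]
    exact MeasurableSet.iUnion fun m => (MeasurableSet.const _).inter
      ((MeasurableSet.const _).inter (S.measurableSet_isActive m))
  exact Measurable.ite (h 1) measurable_const
    (Measurable.ite (h 0) measurable_const measurable_const)

theorem norm_velocity_density_le (N : ℕ) (σ : ℝ) (x : Space 2) :
    ‖velocity (S.density N σ x)‖ ≤ 1 / 2 := by
  have h4 : ‖velocity 4‖ ≤ 1 / 2 := by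
    have := velocity_movingDensity 1
    norm_num [movingDensity, movingSpeed] at this
    norm_num [this, norm_smul]
  have h2 : ‖velocity 2‖ ≤ 1 / 2 := by
    have := velocity_movingDensity 0
    norm_num [movingDensity, movingSpeed] at this
    norm_num [this, norm_smul]
  unfold density
  split_ifs
  exacts [h4, h2, by norm_num [velocity_three]]

theorem intervalIntegrable_density (hN : 0 < N) (z : Space 2) (a b : ℝ) :
    IntervalIntegrable (fun s => S.density N s (S.pos N s z) / 3) volume a b := by
  rw [intervalIntegrable_iff]
  refine Measure.integrableOn_of_bounded (M := 4 / 3) (by simp) ?_ (ae_of_all _ fun s => ?_)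
  · exact (((S.measurable_density N).comp (measurable_id.prodMk
      (S.continuous_pos hN z).measurable)).div_const 3).aestronglyMeasurable
  · have := S.density_mem N s (S.pos N s z)
    rw [Real.norm_eq_abs, abs_le]
    constructor <;> linarith

theorem time_sub (hN : 0 < N) (z : Space 2) (a b : ℝ) :
    S.time N z b - S.time N z a = ∫ s in a..b, S.density N s (S.pos N s z) / 3 := by
  refine (integral_eq_of_hasDerivAt_off_countable _ _ (S.countable_corners N z)
    (S.continuous_time hN z).continuousOn
    (fun s hs => (S.hasDerivAt_pos_time hN z hs.2).2) (S.intervalIntegrable_density hN z a b)).symm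

/-- Since ρ ≥ 2, the slope dt/dσ is at least 2/3; so σ ↦ t is an increasing bijection of ℝ and can
be inverted. -/
theorem le_time_sub (hN : 0 < N) (z : Space 2) {a b : ℝ} (hab : a ≤ b) :
    2 / 3 * (b - a) ≤ S.time N z b - S.time N z a := by
  rw [S.time_sub hN]
  have := intervalIntegral.integral_mono_on hab (intervalIntegrable_const (c := (2 / 3 : ℝ)))
    (S.intervalIntegrable_density hN z a b)
    fun s _ => by linarith [(S.density_mem N s (S.pos N s z)).1]
  rw [intervalIntegral.integral_const, smul_eq_mul] at this
  linarith

theorem time_strictMono (hN : 0 < N) (z : Space 2) : StrictMono (S.time N z) := fun a b hab => by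
  linarith [S.le_time_sub hN z hab.le]

theorem time_surjective (hN : 0 < N) (z : Space 2) : Function.Surjective (S.time N z) := by
  refine (S.continuous_time hN z).surjective ?_ ?_
  · refine tendsto_atTop_mono' atTop ((eventually_ge_atTop 0).mono fun s hs => ?_)
      ((tendsto_id.const_mul_atTop (show (0 : ℝ) < 2 / 3 by norm_num)).atTop_add
        (tendsto_const_nhds (x := S.time N z 0)))
    have := S.le_time_sub hN z hs
    simp only [id]
    linarith
  · refine tendsto_atBot_mono' atBot ((eventually_le_atBot 0).mono fun s hs => ?_)
      ((tendsto_id.const_mul_atBot (show (0 : ℝ) < 2 / 3 by norm_num)).atBot_add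
        (tendsto_const_nhds (x := S.time N z 0)))
    have := S.le_time_sub hN z hs
    simp only [id]
    linarith

/-- The value of `t - x₁ - x₂` at time `t`, along the trajectory with label `z`. -/
def param (N : ℕ) (z : Space 2) (t : ℝ) : ℝ := Function.invFun (S.time N z) t

theorem time_param (hN : 0 < N) (z : Space 2) (t : ℝ) : S.time N z (S.param N z t) = t :=
  Function.rightInverse_invFun (S.time_surjective hN z) t

theorem param_time (hN : 0 < N) (z : Space 2) (σ : ℝ) : S.param N z (S.time N z σ) = σ :=
  Function.leftInverse_invFun (S.time_strictMono hN z).injective σ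

theorem param_strictMono (hN : 0 < N) (z : Space 2) : StrictMono (S.param N z) := fun s t h => by
  rw [← (S.time_strictMono hN z).lt_iff_lt, S.time_param hN, S.time_param hN]
  exact h

theorem param_continuous (hN : 0 < N) (z : Space 2) : Continuous (S.param N z) :=
  (S.param_strictMono hN z).monotone.continuous_of_surjective
    fun σ => ⟨_, S.param_time hN z σ⟩

/-- The position at time `t` of the point with label `z`. -/
def place (N : ℕ) (t : ℝ) (z : Space 2) : Space 2 := S.pos N (S.param N z t) z

/-- The label of the point that is at `x` at time `t`. -/
def label (N : ℕ) (t : ℝ) (x : Space 2) : Space 2 := (S.pos N (t - (x 0 + x 1))).symm x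

theorem sub_sum_place (hN : 0 < N) (t : ℝ) (z : Space 2) :
    t - (S.place N t z 0 + S.place N t z 1) = S.param N z t := by
  have := S.time_param hN z t
  rw [time] at this
  rw [place]
  linarith

theorem label_place (hN : 0 < N) (t : ℝ) (z : Space 2) : S.label N t (S.place N t z) = z := by
  rw [label, S.sub_sum_place hN, place, Equiv.symm_apply_apply]

theorem place_label (hN : 0 < N) (t : ℝ) (x : Space 2) : S.place N t (S.label N t x) = x := by
  have h : S.time N (S.label N t x) (t - (x 0 + x 1)) = t := by
    rw [time, label, Equiv.apply_symm_apply]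
    ring
  have h' : S.param N (S.label N t x) t = t - (x 0 + x 1) := by
    rw [← S.param_time hN (S.label N t x) (t - (x 0 + x 1)), h]
  rw [place, h', label, Equiv.apply_symm_apply]

/-- The velocity field defined by the first `N` arrays. -/
def field (N : ℕ) (t : ℝ) (x : Space 2) : Space 2 :=
  velocity (S.density N (t - (x 0 + x 1)) x)

theorem measurable_density_time (N : ℕ) :
    Measurable fun p : ℝ × Space 2 => S.density N (p.1 - (p.2 0 + p.2 1)) p.2 :=
  (S.measurable_density N).comp (f := fun p : ℝ × Space 2 => (p.1 - (p.2 0 + p.2 1), p.2))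
    (by fun_prop)

theorem measurable_field (N : ℕ) : Measurable fun p : ℝ × Space 2 => S.field N p.1 p.2 :=
  measurable_velocity.comp (S.measurable_density_time N)

theorem norm_field_le (N : ℕ) (t : ℝ) (x : Space 2) : ‖S.field N t x‖ ≤ 1 / 2 :=
  S.norm_velocity_density_le N _ x

theorem continuous_place (hN : 0 < N) (z : Space 2) : Continuous fun t => S.place N t z :=
  (S.continuous_pos hN z).comp (S.param_continuous hN z)

theorem hasDerivAt_place (hN : 0 < N) (z : Space 2) {t : ℝ} (ht : S.param N z t ∉ S.corners N z) :
    HasDerivAt (fun t => S.place N t z) (S.field N t (S.place N t z)) t := by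
  obtain ⟨h1, h2⟩ := S.hasDerivAt_pos_time hN z ht
  have hpos := (S.density_mem N (S.param N z t) (S.pos N (S.param N z t) z)).1
  have hne : S.density N (S.param N z t) (S.pos N (S.param N z t) z) / 3 ≠ 0 := by positivity
  have h3 := HasDerivAt.of_local_left_inverse (S.param_continuous hN z).continuousAt h2 hne
    (Eventually.of_forall (S.time_param hN z))
  have h4 := h1.scomp t h3
  rw [smul_smul, inv_mul_cancel₀ hne, one_smul] at h4
  rw [field, S.sub_sum_place hN]
  exact h4

/-- The O.D.E. holds except at the countably many times of the corners, and the trajectory is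
continuous, so the fundamental theorem of calculus applies. Every initial point is covered. -/
theorem isTrajectory_place (hN : 0 < N) (y : Space 2) :
    IsTrajectory (S.field N) y fun t => S.place N t (S.label N 0 y) := by
  intro t _
  set z := S.label N 0 y with hz
  have hint : IntervalIntegrable (fun s => S.field N s (S.place N s z)) volume 0 t := by
    rw [intervalIntegrable_iff]
    refine Measure.integrableOn_of_bounded (M := 1 / 2) (by simp) ?_
      (ae_of_all _ fun s => S.norm_field_le N s _)
    exact ((S.measurable_field N).comp (measurable_id.prodMk
      (S.continuous_place hN z).measurable)).aestronglyMeasurable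
  refine ⟨hint, ?_⟩
  have hc : (S.param N z ⁻¹' S.corners N z).Countable :=
    (S.countable_corners N z).preimage (S.param_strictMono hN z).injective
  rw [integral_eq_of_hasDerivAt_off_countable _ _ hc (S.continuous_place hN z).continuousOn
    (fun s hs => S.hasDerivAt_place hN z hs.2) hint, hz, S.place_label hN 0 y]
  abel

end ShearSystem

/-! ### Uniqueness of Carathéodory solutions -/

namespace ShearSystem

variable (S : ShearSystem) {N : ℕ}

open Classical in
theorem field_of_onlyAt {m : ℕ} (hm : m < N) {t : ℝ} {x : Space 2}
    (h : S.OnlyAt N m (t - (x 0 + x 1))) :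
    S.field N t x = (if S.IsActive m (t - (x 0 + x 1)) x then movingSpeed (S.axis m) else 0) •
      axisVector (S.axis m) := by
  rw [field, S.density_of_onlyAt hm h]
  split_ifs
  · exact velocity_movingDensity _
  · rw [velocity_three, zero_smul]

theorem trajectory_sub {y : Space 2} {ξ : ℝ → Space 2} (hξ : IsTrajectory (S.field N) y ξ)
    {t₁ t₂ : ℝ} (h₁ : 0 ≤ t₁) (h₂ : 0 ≤ t₂) :
    ξ t₂ - ξ t₁ = ∫ s in t₁..t₂, S.field N s (ξ s) := by
  rw [(hξ t₁ h₁).2, (hξ t₂ h₂).2, ← intervalIntegral.integral_interval_sub_left (hξ t₂ h₂).1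
    (hξ t₁ h₁).1]
  abel

theorem norm_trajectory_sub_le {y : Space 2} {ξ : ℝ → Space 2}
    (hξ : IsTrajectory (S.field N) y ξ) {t₁ t₂ : ℝ} (h₁ : 0 ≤ t₁) (h₂ : 0 ≤ t₂) :
    ‖ξ t₂ - ξ t₁‖ ≤ 1 / 2 * |t₂ - t₁| := by
  rw [S.trajectory_sub hξ h₁ h₂]
  exact intervalIntegral.norm_integral_le_of_norm_le_const fun s _ => S.norm_field_le N s _

theorem continuousOn_trajectory {y : Space 2} {ξ : ℝ → Space 2}
    (hξ : IsTrajectory (S.field N) y ξ) : ContinuousOn ξ (Ici 0) := by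
  refine (LipschitzOnWith.of_dist_le_mul (K := 1) fun s hs t ht => ?_).continuousOn
  rw [dist_eq_norm, Real.dist_eq]
  have := S.norm_trajectory_sub_le hξ (mem_Ici.1 ht) (mem_Ici.1 hs)
  have h0 := abs_nonneg (s - t)
  simp only [NNReal.coe_one, one_mul]
  linarith

theorem hasDerivAt_trajectory {y : Space 2} {ξ : ℝ → Space 2}
    (hξ : IsTrajectory (S.field N) y ξ) {t : ℝ} (ht : 0 < t) {v : Space 2}
    (hv : ∀ᶠ s in 𝓝 t, S.field N s (ξ s) = v) : HasDerivAt ξ v t := by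
  have h1 : HasDerivAt (fun u => ∫ s in (0 : ℝ)..u, S.field N s (ξ s)) v t := by
    have := intervalIntegral.integral_hasDerivAt_right (hξ t ht.le).1
      ⟨Ioo 0 (t + 1), Ioo_mem_nhds ht (by linarith), ?_⟩
      ((continuousAt_const (y := v)).congr_of_eventuallyEq hv)
    · rwa [hv.self_of_nhds] at this
    · have := (hξ (t + 1) (by linarith)).1
      rw [intervalIntegrable_iff_integrableOn_Ioc_of_le (by linarith)] at this
      exact this.aestronglyMeasurable.mono_measure (Measure.restrict_mono Ioo_subset_Ioc_self le_rfl)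
  refine (h1.const_add y).congr_of_eventuallyEq ?_
  exact (eventually_gt_nhds ht).mono fun s hs => (hξ s hs.le).2

/-- While a single array can act, an arbitrary solution keeps its transverse coordinate, so it sees
one fixed σ-interval. It crosses the ends of this interval at most once each, and elsewhere its
displacement follows the ramp; undoing the shear therefore gives a constant. -/
theorem label_trajectory_of_onlyAt {m : ℕ} (hm : m < N) {y : Space 2} {ξ : ℝ → Space 2}
    (hξ : IsTrajectory (S.field N) y ξ) {t₁ t₂ : ℝ} (h₁ : 0 ≤ t₁) (h₁₂ : t₁ ≤ t₂)
    (h : ∀ s ∈ Icc t₁ t₂, S.OnlyAt N m (s - (ξ s 0 + ξ s 1))) :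
    S.label N t₂ (ξ t₂) = S.label N t₁ (ξ t₁) := by
  classical
  set a := S.axis m with ha
  set σ : ℝ → ℝ := fun s => s - (ξ s 0 + ξ s 1) with hσ
  have hnn : ∀ s ∈ Icc t₁ t₂, 0 ≤ s := fun s hs => h₁.trans hs.1
  have hfield : ∀ s ∈ Icc t₁ t₂, S.field N s (ξ s) =
      (if S.IsActive m (σ s) (ξ s) then movingSpeed a else 0) • axisVector a :=
    fun s hs => S.field_of_onlyAt hm (h s hs)
  -- The field is parallel to the axis of the active array, so its transverse component integrates
  -- to zero.
  have hother : ∀ s ∈ Icc t₁ t₂, ξ s (1 - a) = ξ t₁ (1 - a) := by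
    intro s hs
    have hint : IntervalIntegrable (fun s => S.field N s (ξ s)) volume t₁ s :=
      (hξ t₁ h₁).1.symm.trans (hξ s (hnn s hs)).1
    have h0 := congrArg (EuclideanSpace.proj (𝕜 := ℝ) (1 - a)) (S.trajectory_sub hξ h₁ (hnn s hs))
    rw [← ContinuousLinearMap.intervalIntegral_comp_comm _ hint,
      intervalIntegral.integral_congr (g := fun _ => (0 : ℝ))] at h0
    · have h0' : ξ s (1 - a) - ξ t₁ (1 - a) = 0 := by
        rw [intervalIntegral.integral_zero] at h0
        exact h0
      linarith
    · intro u hu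
      rw [uIcc_of_le hs.1] at hu
      have := add_smul_axisVector_other 0
        (if S.IsActive m (σ u) (ξ u) then movingSpeed a else 0) a
      simpa [hfield u ⟨hu.1, hu.2.trans hs.2⟩] using this
  set p := ξ t₁ (1 - a) with hp
  set c := S.enter m p with hc
  set d := S.exit m p with hd
  have hcd : c ≤ d := S.enter_le_exit m p
  have hact : ∀ s ∈ Icc t₁ t₂, (S.IsActive m (σ s) (ξ s) ↔ σ s ∈ Ioc c d) := fun s hs => by
    rw [IsActive, ← ha, hother s hs]
  have hξc : ContinuousOn ξ (Icc t₁ t₂) := (S.continuousOn_trajectory hξ).mono fun s hs => hnn s hs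
  have hσc : ContinuousOn σ (Icc t₁ t₂) := by
    simp only [hσ]
    fun_prop
  -- The longitudinal speed is at most 1/2 < 1, hence σ is strictly increasing along any solution.
  have hinj : InjOn σ (Icc t₁ t₂) := by
    refine StrictMonoOn.injOn fun s hs u hu hsu => ?_
    have h2 := S.norm_trajectory_sub_le hξ (hnn s hs) (hnn u hu)
    have h3 := (abs_le.1 ((PiLp.norm_apply_le (ξ u - ξ s) a).trans h2)).2
    rw [abs_of_pos (sub_pos.2 hsu), PiLp.sub_apply] at h3
    simp only [hσ, sum_eq_axis _ a, hother s hs, hother u hu]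
    linarith
  have hcount : (Icc t₁ t₂ ∩ σ ⁻¹' {c, d}).Countable := by
    refine MapsTo.countable_of_injOn (f := σ) (t := {c, d}) (fun s hs => hs.2)
      (hinj.mono inter_subset_left) (toFinite _).countable
  -- Longitudinal position minus accumulated displacement: its derivative vanishes off the corners.
  have hconst : ξ t₂ a - shearRate a * ramp c d (σ t₂) =
      ξ t₁ a - shearRate a * ramp c d (σ t₁) := by
    have := integral_eq_of_hasDerivAt_off_countable_of_le
      (fun s => ξ s a - shearRate a * ramp c d (σ s)) (fun _ => 0) h₁₂ hcount ?_ ?_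
      intervalIntegrable_const
    · simp only [intervalIntegral.integral_zero] at this
      linarith
    · have h1 : ContinuousOn (fun s => ξ s a) (Icc t₁ t₂) := by fun_prop
      exact h1.sub (continuousOn_const.mul ((continuous_ramp c d).comp_continuousOn hσc))
    · rintro s ⟨hs, hs'⟩
      have hsI := Ioo_subset_Icc_self hs
      have hsc : σ s ≠ c := fun h' => hs' ⟨hsI, Or.inl h'⟩
      have hsd : σ s ≠ d := fun h' => hs' ⟨hsI, Or.inr h'⟩
      have hσs : ContinuousAt σ s := hσc.continuousAt (Icc_mem_nhds hs.1 hs.2)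
      -- Away from the two corners activity is locally constant. The velocity is then locally
      -- constant in time, so the Carathéodory solution is differentiable in the classical sense.
      have hev : ∀ᶠ u in 𝓝 s, (σ u ∈ Ioc c d ↔ σ s ∈ Ioc c d) := by
        have e1 : ∀ᶠ u in 𝓝 s, (c < σ u ↔ c < σ s) := by
          rcases lt_or_gt_of_ne hsc with h' | h'
          · exact (hσs.eventually_lt_const h').mono fun u hu => by
              simp [not_lt.2 hu.le, not_lt.2 h'.le]
          · exact (hσs.eventually_const_lt h').mono fun u hu => by simp [hu, h']
        have e2 : ∀ᶠ u in 𝓝 s, (σ u ≤ d ↔ σ s ≤ d) := by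
          rcases lt_or_gt_of_ne hsd with h' | h'
          · exact (hσs.eventually_lt_const h').mono fun u hu => by simp [hu.le, h'.le]
          · exact (hσs.eventually_const_lt h').mono fun u hu => by
              simp [not_le.2 hu, not_le.2 h']
        exact (e1.and e2).mono fun u hu => and_congr hu.1 hu.2
      set r : ℝ := if σ s ∈ Ioc c d then movingSpeed a else 0 with hr
      have hderiv : HasDerivAt ξ (r • axisVector a) s := by
        refine S.hasDerivAt_trajectory hξ (h₁.trans_lt hs.1)
          ((hev.and (Icc_mem_nhds hs.1 hs.2)).mono fun u hu => ?_)
        rw [hfield u hu.2, if_congr ((hact u hu.2).trans hu.1) rfl rfl]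
      have hcoord : ∀ i, HasDerivAt (fun u => ξ u i) ((r • axisVector a) i) s := fun i =>
        (EuclideanSpace.proj (𝕜 := ℝ) i).hasFDerivAt.comp_hasDerivAt s hderiv
      have hσd : HasDerivAt σ (1 - r) s := by
        have := (hasDerivAt_id s).sub ((hcoord 0).add (hcoord 1))
        have e := sum_add_smul_axisVector 0 r a
        simp only [zero_add, PiLp.zero_apply] at e
        rwa [e] at this
      have e := add_smul_axisVector_self 0 r a
      simp only [zero_add, PiLp.zero_apply] at e
      have h5 := (hcoord a).sub (((hasDerivAt_ramp hcd hsc hsd).comp s hσd).const_mul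
        (shearRate a))
      rw [e] at h5
      refine HasDerivAt.congr_deriv h5 ?_
      by_cases hI : σ s ∈ Ioc c d
      · rw [hr, if_pos hI, indicator_of_mem hI, Pi.one_apply, one_mul, shearRate_mul_one_sub,
          sub_self]
      · rw [hr, if_neg hI, indicator_of_notMem hI]
        ring
  have ht₁ := left_mem_Icc.2 h₁₂
  have ht₂ := right_mem_Icc.2 h₁₂
  rw [label, label, S.pos_eq_shear hm (h _ ht₁), S.pos_eq_shear hm (h _ ht₂),
    Equiv.symm_trans_apply, Equiv.symm_trans_apply]
  congr 1
  rw [shear_symm_apply, shear_symm_apply, ← ha]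
  refine space_ext_axis a ?_ ?_
  · rw [add_smul_axisVector_self, add_smul_axisVector_self, shift, shift, ← ha, hother _ ht₂,
      ← hp, ← hc, ← hd]
    linarith
  · rw [add_smul_axisVector_other, add_smul_axisVector_other, hother _ ht₂]

theorem label_trajectory (hN : 0 < N) {y : Space 2} {ξ : ℝ → Space 2}
    (hξ : IsTrajectory (S.field N) y ξ) {t : ℝ} (ht : 0 ≤ t) :
    S.label N t (ξ t) = S.label N 0 y := by
  have hξ0 : ξ 0 = y := by simpa using (hξ 0 le_rfl).2
  -- Freezing the solution for negative times extends it to ℝ, so that a locally constant function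
  -- of time is constant by connectedness.
  have hξc : Continuous fun s : ℝ => ξ (max s 0) :=
    (S.continuousOn_trajectory hξ).comp_continuous (by fun_prop) fun s => le_max_right s 0
  have hcont : Continuous fun s : ℝ => max s 0 - (ξ (max s 0) 0 + ξ (max s 0) 1) :=
    (continuous_id.max continuous_const).sub
      (((EuclideanSpace.proj (𝕜 := ℝ) 0).continuous.comp hξc).add
        ((EuclideanSpace.proj (𝕜 := ℝ) 1).continuous.comp hξc))
  have hloc : IsLocallyConstant fun s : ℝ => S.label N (max s 0) (ξ (max s 0)) := by
    rw [IsLocallyConstant.iff_eventually_eq]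
    intro s
    obtain ⟨m, hm, h⟩ := S.exists_onlyAt hN (max s 0 - (ξ (max s 0) 0 + ξ (max s 0) 1))
    obtain ⟨ε, hε, h⟩ := Metric.eventually_nhds_iff_ball.1 (hcont.continuousAt.eventually h)
    have key : ∀ s₁ ∈ Metric.ball s ε, ∀ s₂ ∈ Metric.ball s ε, s₁ ≤ s₂ →
        S.label N (max s₂ 0) (ξ (max s₂ 0)) = S.label N (max s₁ 0) (ξ (max s₁ 0)) := by
      intro s₁ h₁ s₂ h₂ h₁₂
      refine S.label_trajectory_of_onlyAt hm hξ (le_max_right _ _) (max_le_max h₁₂ le_rfl)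
        fun r hr => ?_
      have hr0 : 0 ≤ r := (le_max_right _ _).trans hr.1
      rcases le_total s₁ r with h' | h'
      · rcases le_total r s₂ with h'' | h''
        · have := h r ((convex_ball s ε).ordConnected.out h₁ h₂ ⟨h', h''⟩)
          rwa [max_eq_left hr0] at this
        · have := h s₂ h₂
          rcases le_max_iff.1 hr.2 with h3 | h3
          · rwa [max_eq_left (hr0.trans h3), le_antisymm h'' h3] at this
          · rwa [max_eq_right (h''.trans h3), ← le_antisymm h3 hr0] at this
      · have := h s₁ h₁
        rwa [max_eq_left (hr0.trans h'), ← le_antisymm h' ((le_max_left _ _).trans hr.1)] at this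
    filter_upwards [Metric.ball_mem_nhds s hε] with u hu
    rcases le_total s u with hsu | hsu
    · exact key s (Metric.mem_ball_self hε) u hu hsu
    · exact (key u hu s (Metric.mem_ball_self hε) hsu).symm
  have := hloc.apply_eq_of_isPreconnected isPreconnected_univ (mem_univ t) (mem_univ 0)
  simpa [hξ0, ht] using this

theorem trajectory_unique (hN : 0 < N) {y : Space 2} {ξ : ℝ → Space 2}
    (hξ : IsTrajectory (S.field N) y ξ) {t : ℝ} (ht : 0 ≤ t) :
    ξ t = S.place N t (S.label N 0 y) := by
  rw [← S.label_trajectory hN hξ ht, S.place_label hN]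

end ShearSystem

/-! ### Measure preservation by shears and by the change of variables -/

/-- The transverse and the longitudinal coordinate with respect to the `a`-th axis. -/
theorem exists_coordinates (a : Fin 2) : ∃ e : Space 2 ≃ᵐ ℝ × ℝ,
    MeasurePreserving e volume volume ∧ ∀ x, e x = (x (1 - a), x a) := by
  have h : MeasurePreserving
      ((MeasurableEquiv.toLp 2 (Fin 2 → ℝ)).symm.trans MeasurableEquiv.finTwoArrow) :=
    (volume_preserving_finTwoArrow ℝ).comp
      (EuclideanSpace.volume_preserving_symm_measurableEquiv_toLp (Fin 2))
  obtain rfl | rfl : a = 0 ∨ a = 1 := by omega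
  · exact ⟨((MeasurableEquiv.toLp 2 (Fin 2 → ℝ)).symm.trans MeasurableEquiv.finTwoArrow).trans
      MeasurableEquiv.prodComm, (Measure.measurePreserving_swap (μ := volume (α := ℝ)) (ν := volume (α := ℝ))).comp h
      (g := MeasurableEquiv.prodComm), fun x => Prod.ext rfl rfl⟩
  · exact ⟨_, h, fun x => Prod.ext rfl rfl⟩

/-- Each line parallel to the axis is translated, so this is a skew product of translations. -/
theorem measurePreserving_add_smul_axisVector (a : Fin 2) {g : ℝ → ℝ} (hg : Measurable g) :
    MeasurePreserving (fun x : Space 2 => x + g (x (1 - a)) • axisVector a) volume volume := by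
  obtain ⟨e, he, hex⟩ := exists_coordinates a
  have h1 : MeasurePreserving (fun p : ℝ × ℝ => (p.1, p.2 + g p.1)) volume volume :=
    (MeasurePreserving.id volume).skew_product (g := fun p q => q + g p) (by fun_prop)
      (ae_of_all _ fun p => map_add_right_eq_self _ _)
  have h2 := (he.symm e).comp (h1.comp he)
  have : (fun x : Space 2 => x + g (x (1 - a)) • axisVector a) =
      e.symm ∘ (fun p : ℝ × ℝ => (p.1, p.2 + g p.1)) ∘ e := by
    funext x
    apply e.injective
    rw [Function.comp_apply, Function.comp_apply, e.apply_symm_apply, hex, hex]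
    rw [add_smul_axisVector_self, add_smul_axisVector_other]
  rw [this]
  exact h2

theorem measurePreserving_add_sum :
    MeasurePreserving (fun p : ℝ × Space 2 => (p.1 + (p.2 0 + p.2 1), p.2)) volume volume := by
  have h : MeasurePreserving (fun p : Space 2 × ℝ => (p.1, p.2 + (p.1 0 + p.1 1))) volume volume :=
    (MeasurePreserving.id volume).skew_product (g := fun (x : Space 2) (s : ℝ) => s + (x 0 + x 1)) (by fun_prop)
      (ae_of_all _ fun p => map_add_right_eq_self _ _)
  exact Measure.measurePreserving_swap.comp (h.comp Measure.measurePreserving_swap)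

namespace ShearSystem

variable (S : ShearSystem) {N : ℕ}

theorem measurePreserving_shear (m : ℕ) (σ : ℝ) :
    MeasurePreserving (S.shear m σ) volume volume := by
  have h1 := S.measurable_enter m
  have h2 := S.measurable_exit m
  refine measurePreserving_add_smul_axisVector (S.axis m)
    (g := fun p => shearRate (S.axis m) * ramp (S.enter m p) (S.exit m p) σ) ?_
  unfold ramp
  fun_prop

theorem measurePreserving_pos (N : ℕ) (σ : ℝ) :
    MeasurePreserving (S.pos N σ) volume volume := by
  induction N with
  | zero => exact MeasurePreserving.id _
  | succ N ih => exact (S.measurePreserving_shear N σ).comp ih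

/-- The map from `(t - x₁ - x₂, label)` to `(t, x)`. -/
def event (N : ℕ) (p : ℝ × Space 2) : ℝ × Space 2 := (S.time N p.2 p.1, S.pos N p.1 p.2)

/-- For fixed σ the position is a composition of shears in z; replacing σ by t = σ + x₁ + x₂ is one
more shear. With no Jacobian, space-time integrals become integrals along trajectories by Fubini. -/
theorem measurePreserving_event (N : ℕ) : MeasurePreserving (S.event N) volume volume :=
  measurePreserving_add_sum.comp ((MeasurePreserving.id volume).skew_product
    (g := fun σ z => S.pos N σ z) (S.measurable_pos N)
    (ae_of_all _ fun σ => (S.measurePreserving_pos N σ).map_eq))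

theorem time_sub_sum (N : ℕ) (σ : ℝ) (z : Space 2) :
    S.time N z σ - (S.pos N σ z 0 + S.pos N σ z 1) = σ := by
  rw [time]; ring

theorem label_event (N : ℕ) (σ : ℝ) (z : Space 2) :
    S.label N (S.time N z σ) (S.pos N σ z) = z := by
  rw [label, time_sub_sum, Equiv.symm_apply_apply]

theorem event_injective (N : ℕ) : Function.Injective (S.event N) := by
  rintro ⟨σ, z⟩ ⟨σ', z'⟩ h
  obtain ⟨h1, h2⟩ := Prod.mk.inj h
  have e1 := S.label_event N σ z
  have e2 := S.time_sub_sum N σ z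
  rw [h1, h2] at e1 e2
  rw [Prod.mk.injEq, ← e1, ← e2]
  exact ⟨S.time_sub_sum N σ' z', S.label_event N σ' z'⟩

theorem measurableEmbedding_event (N : ℕ) : MeasurableEmbedding (S.event N) :=
  (S.measurePreserving_event N).measurable.measurableEmbedding (S.event_injective N)

theorem measurable_label_uncurry (N : ℕ) :
    Measurable fun p : ℝ × Space 2 => S.label N p.1 p.2 :=
  (S.measurable_pos_symm N).comp (f := fun p : ℝ × Space 2 => (p.1 - (p.2 0 + p.2 1), p.2))
    (by fun_prop)

theorem measurable_label (N : ℕ) (t : ℝ) : Measurable (S.label N t) :=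
  (S.measurable_label_uncurry N).comp measurable_prodMk_left

theorem measurableEmbedding_label (hN : 0 < N) (t : ℝ) : MeasurableEmbedding (S.label N t) :=
  (S.measurable_label N t).measurableEmbedding
    (Function.LeftInverse.injective (S.place_label hN t))

/-- The definition through an inverse function does not give measurability. Preimages under this map
are images under its inverse, an injective measurable map between standard Borel spaces. -/
theorem measurable_place (hN : 0 < N) (t : ℝ) : Measurable (S.place N t) := by
  intro s hs
  have : S.place N t ⁻¹' s = S.label N t '' s :=
    (congrFun (Set.image_eq_preimage_of_inverse (S.place_label hN t) (S.label_place hN t)) s).symm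
  rw [this]
  exact (S.measurableEmbedding_label hN t).measurableSet_image.2 hs

theorem measurableEmbedding_place (hN : 0 < N) (t : ℝ) : MeasurableEmbedding (S.place N t) :=
  (S.measurable_place hN t).measurableEmbedding
    (Function.LeftInverse.injective (S.label_place hN t))

end ShearSystem

/-! ### Test functions and transport with constant velocity -/

section Transport

variable {φ : ℝ × Space 2 → ℝ}

theorem IsTestFunction.continuous_fderiv (hφ : IsTestFunction φ) : Continuous (fderiv ℝ φ) :=
  hφ.smooth.continuous_fderiv (by simp)

theorem IsTestFunction.integrable_norm_fderiv (hφ : IsTestFunction φ) :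
    Integrable fun p => ‖fderiv ℝ φ p‖ :=
  (hφ.continuous_fderiv.integrable_of_hasCompactSupport (hφ.compactSupport.fderiv (𝕜 := ℝ))).norm

theorem IsTestFunction.integrable_fderiv_apply (hφ : IsTestFunction φ)
    {w : ℝ × Space 2 → ℝ × Space 2} (hw : Measurable w) {C : ℝ} (hC : ∀ p, ‖w p‖ ≤ C) :
    Integrable fun p => fderiv ℝ φ p (w p) := by
  refine (hφ.integrable_norm_fderiv.mul_const C).mono' ?_ (ae_of_all _ fun p => ?_)
  · exact (ContinuousLinearMap.id ℝ (ℝ × Space 2 →L[ℝ] ℝ)).aestronglyMeasurable_comp₂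
      hφ.continuous_fderiv.aestronglyMeasurable hw.aestronglyMeasurable
  · exact ((fderiv ℝ φ p).le_opNorm _).trans (by gcongr; exact hC p)

theorem IsTestFunction.hasFDerivAt (hφ : IsTestFunction φ) (p : ℝ × Space 2) :
    HasFDerivAt φ (fderiv ℝ φ p) p :=
  (hφ.smooth.differentiable (by simp)).differentiableAt.hasFDerivAt

theorem IsTestFunction.integral_line (hφ : IsTestFunction φ) (y v : Space 2) (t₀ : ℝ) :
    ∫ t in Ioi t₀, fderiv ℝ φ (t, y + t • v) (1, v) = -φ (t₀, y + t₀ • v) := by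
  have hline : ∀ t, HasDerivAt (fun t : ℝ => (t, y + t • v)) (1, v) t := fun t => by
    simpa using (hasDerivAt_id t).prodMk (((hasDerivAt_id t).smul_const v).const_add y)
  have hd : ∀ t, HasDerivAt (fun t : ℝ => φ (t, y + t • v)) (fderiv ℝ φ (t, y + t • v) (1, v)) t :=
    fun t => (hφ.hasFDerivAt _).comp_hasDerivAt t (hline t)
  have hemb : IsClosedEmbedding fun t : ℝ => (t, y + t • v) :=
    Function.LeftInverse.isClosedEmbedding (f := Prod.fst) (fun _ => rfl) (by fun_prop) (by fun_prop)
  have := HasCompactSupport.integral_Ioi_deriv_eq (f := fun t : ℝ => φ (t, y + t • v)) ?_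
    (hφ.compactSupport.comp_isClosedEmbedding hemb) t₀
  · simpa only [(hd _).deriv] using this
  · exact (hφ.smooth.comp (by fun_prop)).of_le (by exact_mod_cast le_top)

theorem IsTestFunction.integrable_transport (hφ : IsTestFunction φ) {g : Space 2 → ℝ}
    (hg : Measurable g) {M : ℝ} (hM : ∀ x, ‖g x‖ ≤ M) (v : Space 2) :
    Integrable fun p : ℝ × Space 2 => g (p.2 - p.1 • v) * fderiv ℝ φ p (1, v) :=
  (hφ.integrable_fderiv_apply (measurable_const (a := ((1 : ℝ), v))) fun _ => le_rfl).bdd_mul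
    (hg.comp (by fun_prop)).aestronglyMeasurable (ae_of_all _ fun p => hM _)

/-- Substitute x = y + t v, so that g depends on y alone, and integrate the total derivative of φ
along each line. -/
theorem IsTestFunction.integral_transport (hφ : IsTestFunction φ) {g : Space 2 → ℝ}
    (hg : Measurable g) {M : ℝ} (hM : ∀ x, ‖g x‖ ≤ M) (v : Space 2) (t₀ : ℝ) :
    ∫ p in Ioi t₀ ×ˢ univ, g (p.2 - p.1 • v) * fderiv ℝ φ p (1, v) =
      -∫ x, g (x - t₀ • v) * φ (t₀, x) := by
  have hmp : MeasurePreserving (fun p : ℝ × Space 2 => (p.1, p.2 + p.1 • v)) volume volume :=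
    (MeasurePreserving.id volume).skew_product (g := fun (t : ℝ) (y : Space 2) => y + t • v)
      (by fun_prop) (ae_of_all _ fun p => map_add_right_eq_self _ _)
  have hemb : MeasurableEmbedding (fun p : ℝ × Space 2 => (p.1, p.2 + p.1 • v)) := by
    refine hmp.measurable.measurableEmbedding fun p q h => ?_
    obtain ⟨h1, h2⟩ := Prod.mk.inj h
    rw [h1] at h2
    exact Prod.ext h1 (add_right_cancel h2)
  have hint' : Integrable fun p : ℝ × Space 2 => g p.2 * fderiv ℝ φ (p.1, p.2 + p.1 • v) (1, v) := by
    simpa [Function.comp_def] using hmp.integrable_comp_of_integrable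
      (hφ.integrable_transport hg hM v)
  rw [← hmp.setIntegral_preimage_emb hemb]
  have hpre : (fun p : ℝ × Space 2 => (p.1, p.2 + p.1 • v)) ⁻¹' (Ioi t₀ ×ˢ univ) =
      Ioi t₀ ×ˢ univ := by
    ext p; simp
  simp only [hpre, add_sub_cancel_right]
  rw [Measure.volume_eq_prod, ← Measure.prod_restrict, integral_prod_symm]
  · simp only [integral_const_mul, hφ.integral_line, Measure.restrict_univ, mul_neg, integral_neg]
    rw [← integral_sub_right_eq_self (fun y => g y * φ (t₀, y + t₀ • v)) (t₀ • v)]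
    simp only [sub_add_cancel]
  · rw [Measure.prod_restrict]
    exact hint'.integrableOn

end Transport

theorem IsTestFunction.exists_bound {φ : ℝ × Space 2 → ℝ} (hφ : IsTestFunction φ) :
    ∃ C, ∀ p : ℝ × Space 2, C < p.1 → φ p = 0 ∧ fderiv ℝ φ p = 0 := by
  obtain ⟨C, hC⟩ := hφ.compactSupport.isCompact.isBounded.subset_closedBall 0
  refine ⟨C, fun p hp => ?_⟩
  have : p ∉ tsupport φ := fun h => by
    have h1 := mem_closedBall_zero_iff.1 (hC h)
    have h2 := (le_abs_self p.1).trans ((norm_fst_le p).trans h1)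
    linarith
  exact ⟨image_eq_zero_of_notMem_tsupport this, fderiv_of_notMem_tsupport ℝ this⟩

theorem IsTestFunction.continuous {φ : ℝ × Space 2 → ℝ} (hφ : IsTestFunction φ) : Continuous φ :=
  hφ.smooth.continuous

theorem IsTestFunction.hasCompactSupport_slice {φ : ℝ × Space 2 → ℝ} (hφ : IsTestFunction φ)
    (t : ℝ) : HasCompactSupport fun x => φ (t, x) :=
  hφ.compactSupport.comp_isClosedEmbedding
    (Function.LeftInverse.isClosedEmbedding (f := Prod.snd) (fun _ => rfl) (by fun_prop)
      (by fun_prop))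

theorem IsTestFunction.integrable_slice {φ : ℝ × Space 2 → ℝ} (hφ : IsTestFunction φ) (t : ℝ) :
    Integrable fun x => φ (t, x) :=
  (hφ.continuous.comp (by fun_prop : Continuous fun x : Space 2 => (t, x))).integrable_of_hasCompactSupport
    (hφ.hasCompactSupport_slice t)

/-! ### The weak formulation along trajectories and along moving arrays -/

namespace ShearSystem

variable (S : ShearSystem) {N : ℕ}

/-- The density at the point `x` at time `t`. -/
def densityAt (N : ℕ) (t : ℝ) (x : Space 2) : ℝ := S.density N (t - (x 0 + x 1)) x

theorem densityAt_event (N : ℕ) (σ : ℝ) (z : Space 2) :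
    S.densityAt N (S.time N z σ) (S.pos N σ z) = S.density N σ (S.pos N σ z) := by
  rw [densityAt, time_sub_sum]

theorem field_event (N : ℕ) (σ : ℝ) (z : Space 2) :
    S.field N (S.time N z σ) (S.pos N σ z) = velocity (S.density N σ (S.pos N σ z)) := by
  rw [field, time_sub_sum]

theorem norm_density_le (N : ℕ) (σ : ℝ) (x : Space 2) : ‖S.density N σ x‖ ≤ 4 := by
  have := S.density_mem N σ x
  rw [Real.norm_eq_abs, abs_le]
  constructor <;> linarith

theorem norm_one_field_le (N : ℕ) (t : ℝ) (x : Space 2) : ‖((1 : ℝ), S.field N t x)‖ ≤ 1 := by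
  rw [Prod.norm_def]
  refine max_le (by simp) ((S.norm_field_le N t x).trans (by norm_num))

variable {φ : ℝ × Space 2 → ℝ}

/-- By dt/dσ = ρ/3 and dx/dσ = (ρ/3) f(ρ), the integrand is three times the σ-derivative of φ along
the trajectory. -/
theorem integral_trajectory (hN : 0 < N) (hφ : IsTestFunction φ) (z : Space 2) (t₀ : ℝ) :
    ∫ σ in Ioi (S.param N z t₀), S.densityAt N (S.time N z σ) (S.pos N σ z) *
      fderiv ℝ φ (S.event N (σ, z)) (1, S.field N (S.time N z σ) (S.pos N σ z)) =
      -3 * φ (t₀, S.place N t₀ z) := by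
  simp only [densityAt_event, field_event]
  set a := S.param N z t₀ with ha
  set f' : ℝ → ℝ := fun σ => S.density N σ (S.pos N σ z) *
      fderiv ℝ φ (S.event N (σ, z)) (1, velocity (S.density N σ (S.pos N σ z))) with hf'
  obtain ⟨C, hC⟩ := hφ.exists_bound
  -- Since dt/dσ ≥ 2/3, beyond this σ the time exceeds C and φ vanishes.
  set R := max a (a + 3 / 2 * (C - S.time N z a)) + 1 with hR
  have haR : a ≤ R := by linarith [le_max_left a (a + 3 / 2 * (C - S.time N z a))]
  have htime : ∀ σ, R ≤ σ → C < S.time N z σ := fun σ hσ => by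
    have := S.le_time_sub hN z (haR.trans hσ)
    have := le_max_right a (a + 3 / 2 * (C - S.time N z a))
    linarith
  have hcont : Continuous fun σ => S.event N (σ, z) :=
    (S.continuous_time hN z).prodMk (S.continuous_pos hN z)
  have hmeas : Measurable fun σ => S.density N σ (S.pos N σ z) :=
    (S.measurable_density N).comp (measurable_id.prodMk (S.continuous_pos hN z).measurable)
  have hint : IntervalIntegrable f' volume a R := by
    obtain ⟨B, hB⟩ := (isCompact_Icc (a := a) (b := R)).exists_bound_of_continuousOn
      (hφ.continuous_fderiv.comp hcont).continuousOn
    rw [intervalIntegrable_iff_integrableOn_Icc_of_le haR]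
    refine Measure.integrableOn_of_bounded (M := 4 * B) (by simp) ?_ ?_
    · exact hmeas.aestronglyMeasurable.mul
        ((ContinuousLinearMap.id ℝ (ℝ × Space 2 →L[ℝ] ℝ)).aestronglyMeasurable_comp₂
          (hφ.continuous_fderiv.comp hcont).aestronglyMeasurable
          (measurable_const.prodMk (measurable_velocity.comp hmeas)).aestronglyMeasurable)
    · refine (ae_restrict_iff' measurableSet_Icc).2 (ae_of_all _ fun σ hσ => ?_)
      rw [hf', norm_mul]
      refine mul_le_mul (S.norm_density_le N _ _) ?_ (norm_nonneg _) (by norm_num)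
      refine ((fderiv ℝ φ _).le_opNorm _).trans ((mul_le_of_le_one_right (norm_nonneg _) ?_).trans
        (hB σ hσ))
      exact max_le (by simp) ((S.norm_velocity_density_le N _ _).trans (by norm_num))
  have hftc : ∫ σ in a..R, f' σ = 3 * φ (S.event N (R, z)) - 3 * φ (S.event N (a, z)) := by
    refine integral_eq_of_hasDerivAt_off_countable (fun σ => 3 * φ (S.event N (σ, z))) f'
      (S.countable_corners N z) 
      (continuous_const.mul (hφ.continuous.comp hcont)).continuousOn (fun σ hσ => ?_) hint
    obtain ⟨h1, h2⟩ := S.hasDerivAt_pos_time hN z hσ.2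
    refine (((hφ.hasFDerivAt _).comp_hasDerivAt σ (h2.prodMk h1)).const_mul 3).congr_deriv ?_
    have : (S.density N σ (S.pos N σ z) / 3, (S.density N σ (S.pos N σ z) / 3) •
        velocity (S.density N σ (S.pos N σ z))) = (S.density N σ (S.pos N σ z) / 3) •
        ((1 : ℝ), velocity (S.density N σ (S.pos N σ z))) := by
      rw [Prod.smul_mk, smul_eq_mul, mul_one]
    rw [this, map_smul, smul_eq_mul]
    simp only [hf', event]
    ring
  rw [setIntegral_eq_of_subset_of_forall_sdiff_eq_zero (s := Ioc a R) measurableSet_Ioi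
    Ioc_subset_Ioi_self, ← intervalIntegral.integral_of_le haR, hftc,
    (hC (S.event N (R, z)) (htime R le_rfl)).1, event, ha, S.time_param hN, place]
  · ring
  · rintro σ ⟨h1, h2⟩
    have : R ≤ σ := by
      by_contra h
      exact h2 ⟨h1, (not_le.1 h).le⟩
    simp only [(hC (S.event N (σ, z)) (htime σ this)).2, zero_apply, mul_zero]

variable {E : Type*} [NormedAddCommGroup E] [NormedSpace ℝ E]

theorem integrable_label_transport (N : ℕ) (hφ : IsTestFunction φ) {g : Space 2 → E}
    (hg : StronglyMeasurable g) {M : ℝ} (hM : ∀ x, ‖g x‖ ≤ M) :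
    Integrable fun p : ℝ × Space 2 => (S.densityAt N p.1 p.2 *
      fderiv ℝ φ p (1, S.field N p.1 p.2)) • g (S.label N p.1 p.2) := by
  have h1 : Integrable fun p : ℝ × Space 2 => fderiv ℝ φ p (1, S.field N p.1 p.2) :=
    hφ.integrable_fderiv_apply (measurable_const.prodMk (S.measurable_field N))
      fun p => S.norm_one_field_le N p.1 p.2
  have h2 : Integrable fun p : ℝ × Space 2 => S.densityAt N p.1 p.2 *
      fderiv ℝ φ p (1, S.field N p.1 p.2) :=
    h1.bdd_mul (S.measurable_density_time N).aestronglyMeasurable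
      (ae_of_all _ fun p => S.norm_density_le N _ _)
  exact h2.smul_bdd M (hg.comp_measurable (S.measurable_label_uncurry N)).aestronglyMeasurable
    (ae_of_all _ fun p => hM _)

/-- In the coordinates (σ, z) the label is z itself, so g factors out of the inner integral, which
is a boundary term. -/
theorem integral_label_transport [CompleteSpace E] (hN : 0 < N) (hφ : IsTestFunction φ)
    {g : Space 2 → E} (hg : StronglyMeasurable g) {M : ℝ} (hM : ∀ x, ‖g x‖ ≤ M) (t₀ : ℝ) :
    ∫ p in Ioi t₀ ×ˢ univ, (S.densityAt N p.1 p.2 *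
      fderiv ℝ φ p (1, S.field N p.1 p.2)) • g (S.label N p.1 p.2) =
      -∫ z, (3 * φ (t₀, S.place N t₀ z)) • g z := by
  have hint := S.integrable_label_transport N hφ hg hM
  have hmp := S.measurePreserving_event N
  have hemb := S.measurableEmbedding_event N
  have hint' := hmp.integrable_comp_of_integrable hint
  have hset : MeasurableSet (S.event N ⁻¹' (Ioi t₀ ×ˢ univ)) :=
    hmp.measurable (measurableSet_Ioi.prod MeasurableSet.univ)
  rw [← hmp.setIntegral_preimage_emb hemb, ← integral_indicator hset, Measure.volume_eq_prod,
    integral_prod_symm _ (by rw [← Measure.volume_eq_prod]; exact hint'.indicator hset),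
    ← integral_neg]
  refine integral_congr_ae (ae_of_all _ fun z => ?_)
  have hind : ∀ σ, (S.event N ⁻¹' (Ioi t₀ ×ˢ univ)).indicator
      (fun p => (S.densityAt N (S.event N p).1 (S.event N p).2 * fderiv ℝ φ (S.event N p)
        (1, S.field N (S.event N p).1 (S.event N p).2)) •
        g (S.label N (S.event N p).1 (S.event N p).2)) (σ, z) =
      (Ioi (S.param N z t₀)).indicator (fun σ => (S.densityAt N (S.time N z σ) (S.pos N σ z) *
        fderiv ℝ φ (S.event N (σ, z)) (1, S.field N (S.time N z σ) (S.pos N σ z))) • g z) σ := by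
    intro σ
    have hiff : (σ, z) ∈ S.event N ⁻¹' (Ioi t₀ ×ˢ univ) ↔ σ ∈ Ioi (S.param N z t₀) := by
      rw [mem_preimage, event, mem_prod, mem_Ioi, mem_Ioi,
        ← (S.time_strictMono hN z).lt_iff_lt (a := S.param N z t₀), S.time_param hN]
      simp
    by_cases h : σ ∈ Ioi (S.param N z t₀)
    · rw [indicator_of_mem (hiff.2 h), indicator_of_mem h, event, S.label_event]
    · rw [indicator_of_notMem (mt hiff.1 h), indicator_of_notMem h]
  simp only [hind]
  rw [integral_indicator measurableSet_Ioi, integral_smul_const, S.integral_trajectory hN hφ,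
    ← neg_smul, neg_mul]

/-- The set covered at time `0` by the arrays moving along the `a`-th axis. -/
def occupied (N : ℕ) (a : Fin 2) : Set (Space 2) :=
  {x | ∃ m < N, S.axis m = a ∧ S.IsActive m (-(x 0 + x 1)) x}

/-- Following the array back to time 0 lowers x₁ + x₂ by t and keeps the transverse coordinate: the
array moves rigidly with unit speed. -/
theorem isActive_sub (m : ℕ) (t : ℝ) (x : Space 2) :
    S.IsActive m (-((x - t • axisVector (S.axis m)) 0 + (x - t • axisVector (S.axis m)) 1))
      (x - t • axisVector (S.axis m)) ↔ S.IsActive m (t - (x 0 + x 1)) x := by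
  rw [sub_eq_add_neg x, ← neg_smul, sum_add_smul_axisVector, IsActive,
    add_smul_axisVector_other, neg_add, neg_neg, IsActive]
  ring_nf

theorem sub_mem_occupied (a : Fin 2) (t : ℝ) (x : Space 2) :
    x - t • axisVector a ∈ S.occupied N a ↔
      ∃ m < N, S.axis m = a ∧ S.IsActive m (t - (x 0 + x 1)) x := by
  refine exists_congr fun m => and_congr_right fun _ => and_congr_right fun h => ?_
  subst h
  exact S.isActive_sub m t x

theorem measurableSet_occupied (N : ℕ) (a : Fin 2) : MeasurableSet (S.occupied N a) := by
  have : S.occupied N a = ⋃ m ∈ {m | m < N ∧ S.axis m = a},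
      (fun x : Space 2 => (-(x 0 + x 1), x)) ⁻¹' {p | S.IsActive m p.1 p.2} := by
    ext x
    simp [occupied, and_assoc]
  rw [this]
  exact MeasurableSet.biUnion (to_countable _) fun m _ =>
    (by fun_prop : Measurable fun x : Space 2 => (-(x 0 + x 1), x)) (S.measurableSet_isActive m)

/-- The indicator function of the set covered at time `t` by the arrays moving along the
`a`-th axis. -/
def phase (N : ℕ) (a : Fin 2) (t : ℝ) (x : Space 2) : ℝ :=
  (S.occupied N a).indicator 1 (x - t • axisVector a)

open Classical in
theorem densityAt_cases (N : ℕ) (t : ℝ) (x : Space 2) :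
    (S.densityAt N t x = 4 ∧ S.phase N 1 t x = 1 ∧ S.phase N 0 t x = 0) ∨
    (S.densityAt N t x = 2 ∧ S.phase N 1 t x = 0 ∧ S.phase N 0 t x = 1) ∨
    (S.densityAt N t x = 3 ∧ S.phase N 1 t x = 0 ∧ S.phase N 0 t x = 0) := by
  have h1 := S.sub_mem_occupied (N := N) 1 t x
  have h0 := S.sub_mem_occupied (N := N) 0 t x
  -- A point covered by arrays of both kinds would have its σ in two disjoint windows.
  have hdis : ¬ (x - t • axisVector 1 ∈ S.occupied N 1 ∧ x - t • axisVector 0 ∈ S.occupied N 0) := by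
    rw [h1, h0]
    rintro ⟨⟨m, hm, ha, hact⟩, l, hl, ha', hact'⟩
    have key : ∀ i j, i < j → S.IsActive i (t - (x 0 + x 1)) x →
        S.IsActive j (t - (x 0 + x 1)) x → False := fun i j hij h h' =>
      absurd ((S.lo_le_enter j _).trans_lt h'.1)
        (not_lt.2 ((h.2.trans (S.exit_le_hi i _)).trans (S.hi_lt_lo_of_lt hij).le))
    rcases lt_trichotomy m l with h | h | h
    · exact key _ _ h hact hact'
    · rw [h, ha'] at ha
      exact absurd ha (by decide)
    · exact key _ _ h hact' hact
  rw [densityAt, density, if_congr h1.symm rfl rfl, if_congr h0.symm rfl rfl, phase, phase]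
  by_cases c1 : x - t • axisVector 1 ∈ S.occupied N 1 <;>
  by_cases c0 : x - t • axisVector 0 ∈ S.occupied N 0
  · exact absurd ⟨c1, c0⟩ hdis
  all_goals simp [c1, c0]

theorem norm_phase_le (N : ℕ) (a : Fin 2) (x : Space 2) :
    ‖(S.occupied N a).indicator (1 : Space 2 → ℝ) x‖ ≤ 1 := by
  unfold indicator
  split_ifs <;> simp

theorem integrable_phase (N : ℕ) (hφ : IsTestFunction φ) (a : Fin 2) :
    Integrable fun p : ℝ × Space 2 => S.phase N a p.1 p.2 * fderiv ℝ φ p (1, axisVector a) :=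
  hφ.integrable_transport (measurable_one.indicator (S.measurableSet_occupied N a))
    (S.norm_phase_le N a) _

/-- The transport formula handles directions (1, v) only; hence the constant part (A, W) is split as
(A - 1)(1, 0) + (1, W). -/
theorem fderiv_phase (N : ℕ) (A B₁ B₀ : ℝ) (W : Space 2) (p : ℝ × Space 2) :
    fderiv ℝ φ p (A + B₁ * S.phase N 1 p.1 p.2 + B₀ * S.phase N 0 p.1 p.2,
        W + (B₁ * S.phase N 1 p.1 p.2) • axisVector 1 +
          (B₀ * S.phase N 0 p.1 p.2) • axisVector 0) =
      ((A - 1) * fderiv ℝ φ p (1, 0) + fderiv ℝ φ p (1, W)) +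
      (B₁ * (S.phase N 1 p.1 p.2 * fderiv ℝ φ p (1, axisVector 1)) +
      B₀ * (S.phase N 0 p.1 p.2 * fderiv ℝ φ p (1, axisVector 0))) := by
  simp only [← smul_eq_mul, ← map_smul, ← map_add, Prod.smul_mk, Prod.mk_add_mk, smul_zero]
  congr 2
  · simp only [smul_eq_mul]; ring
  · simp only [smul_smul, smul_eq_mul, zero_add, add_assoc]

theorem integrable_phases (N : ℕ) (hφ : IsTestFunction φ) (A B₁ B₀ : ℝ) (W : Space 2) :
    Integrable fun p : ℝ × Space 2 => fderiv ℝ φ p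
      (A + B₁ * S.phase N 1 p.1 p.2 + B₀ * S.phase N 0 p.1 p.2,
        W + (B₁ * S.phase N 1 p.1 p.2) • axisVector 1 +
          (B₀ * S.phase N 0 p.1 p.2) • axisVector 0) := by
  have hD : ∀ v : Space 2, Integrable fun p : ℝ × Space 2 => fderiv ℝ φ p (1, v) := fun v =>
    hφ.integrable_fderiv_apply (measurable_const (a := ((1 : ℝ), v))) fun _ => le_rfl
  simp only [fderiv_phase]
  exact (((hD 0).const_mul _).add (hD W)).add (((S.integrable_phase N hφ 1).const_mul _).add
    ((S.integrable_phase N hφ 0).const_mul _))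

/-- Such a density-flux pair is a constant pair plus multiples of indicators travelling with
matching velocity, so it is divergence free in space-time. The mass and all Kruzhkov entropies of ρ
have this form. -/
theorem integral_phases (N : ℕ) (hφ : IsTestFunction φ) (A B₁ B₀ : ℝ) (W : Space 2) (t₀ : ℝ) :
    ∫ p in Ioi t₀ ×ˢ univ, fderiv ℝ φ p
      (A + B₁ * S.phase N 1 p.1 p.2 + B₀ * S.phase N 0 p.1 p.2,
        W + (B₁ * S.phase N 1 p.1 p.2) • axisVector 1 +
          (B₀ * S.phase N 0 p.1 p.2) • axisVector 0) =
      -∫ x, (A + B₁ * S.phase N 1 t₀ x + B₀ * S.phase N 0 t₀ x) * φ (t₀, x) := by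
  have hD : ∀ v : Space 2, Integrable fun p : ℝ × Space 2 => fderiv ℝ φ p (1, v) := fun v =>
    hφ.integrable_fderiv_apply (measurable_const (a := ((1 : ℝ), v))) fun _ => le_rfl
  have hT : ∀ v : Space 2, ∫ p in Ioi t₀ ×ˢ univ, fderiv ℝ φ p (1, v) = -∫ x, φ (t₀, x) :=
    fun v => by
      simpa using hφ.integral_transport (g := fun _ => 1) measurable_const (M := 1) (by simp) v t₀
  have hP : ∀ a, ∫ p in Ioi t₀ ×ˢ univ, S.phase N a p.1 p.2 * fderiv ℝ φ p (1, axisVector a) =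
      -∫ x, S.phase N a t₀ x * φ (t₀, x) := fun a =>
    hφ.integral_transport (measurable_one.indicator (S.measurableSet_occupied N a))
      (S.norm_phase_le N a) _ _
  have hφ0 := hφ.integrable_slice t₀
  have hφa : ∀ a, Integrable fun x => S.phase N a t₀ x * φ (t₀, x) := fun a =>
    hφ0.bdd_mul ((measurable_one.indicator (S.measurableSet_occupied N a)).comp
      (by fun_prop : Measurable fun x : Space 2 => x - t₀ • axisVector a)).aestronglyMeasurable
      (ae_of_all _ fun x => S.norm_phase_le N a _)
  simp only [fderiv_phase]
  have i1 := (((hD 0).const_mul (A - 1)).add (hD W)).integrableOn (s := Ioi t₀ ×ˢ univ)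
  have i2 := (((S.integrable_phase N hφ 1).const_mul B₁).add
    ((S.integrable_phase N hφ 0).const_mul B₀)).integrableOn (s := Ioi t₀ ×ˢ univ)
  have e1 := integral_add ((hD 0).const_mul (A - 1)).integrableOn (hD W).integrableOn
    (μ := volume.restrict (Ioi t₀ ×ˢ univ))
  have e2 := integral_add ((S.integrable_phase N hφ 1).const_mul B₁).integrableOn
    ((S.integrable_phase N hφ 0).const_mul B₀).integrableOn
    (μ := volume.restrict (Ioi t₀ ×ˢ univ))
  have e3 := integral_add i1 i2
  simp only [Pi.add_apply] at e3
  rw [e3, e1, e2, integral_const_mul, integral_const_mul, integral_const_mul, hT, hT, hP, hP]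
  have e4 : ∀ x, (A + B₁ * S.phase N 1 t₀ x + B₀ * S.phase N 0 t₀ x) * φ (t₀, x) =
      A * φ (t₀, x) + (B₁ * (S.phase N 1 t₀ x * φ (t₀, x)) +
        B₀ * (S.phase N 0 t₀ x * φ (t₀, x))) := fun x => by ring
  have e5 := integral_add (hφ0.const_mul A) (((hφa 1).const_mul B₁).add ((hφa 0).const_mul B₀))
  simp only [Pi.add_apply] at e5
  simp only [e4]
  rw [e5, integral_add ((hφa 1).const_mul B₁) ((hφa 0).const_mul B₀), integral_const_mul,
    integral_const_mul, integral_const_mul]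
  ring

end ShearSystem

/-! ### Flux values and Kruzhkov entropy fluxes -/

theorem smul_velocity (r : ℝ) : r • velocity r = flux r := by
  unfold velocity flux
  split_ifs with h1 h2 h3
  · simp
  all_goals
    have hr : r ≠ 0 := by intro h; rw [h] at h1; norm_num at h1
    ext i
    fin_cases i <;> simp [hr]

theorem flux_two : flux 2 = -axisVector 0 := by
  ext i; fin_cases i <;> norm_num [flux]

theorem flux_three : flux 3 = 0 := by
  ext i; fin_cases i <;> norm_num [flux]

theorem flux_four : flux 4 = axisVector 1 := by
  ext i; fin_cases i <;> norm_num [flux]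

theorem flux_of_mem_two_three {c : ℝ} (h2 : 2 ≤ c) (h3 : c ≤ 3) : flux c = (c - 3) • axisVector 0 := by
  rcases h2.eq_or_lt with rfl | h
  · rw [flux_two]; norm_num
  · ext i; fin_cases i <;> simp [flux, not_le.2 (by linarith : 1 < c), not_le.2 h, h3]

theorem flux_of_three_le {c : ℝ} (h3 : 3 ≤ c) : flux c = (c - 3) • axisVector 1 := by
  rcases h3.eq_or_lt with rfl | h
  · rw [flux_three]; norm_num
  · ext i; fin_cases i <;> simp [flux, not_le.2 (by linarith : 1 < c),
      not_le.2 (by linarith : 2 < c), not_le.2 h]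

/-- Between 3 and 4 the flux is affine with slope e₂. So for every c the jump of the entropy flux is
e₂ times the jump of the entropy: the Rankine–Hugoniot relation for an interface with velocity e₂.
-/
theorem entropyFlux_four (c : ℝ) :
    Real.sign (4 - c) • (flux 4 - flux c) =
      Real.sign (3 - c) • (flux 3 - flux c) + (|4 - c| - |3 - c|) • axisVector 1 := by
  rw [flux_three, flux_four]
  rcases lt_trichotomy c 3 with h | rfl | h
  · rw [Real.sign_of_pos (by linarith), Real.sign_of_pos (by linarith), abs_of_pos (by linarith),
      abs_of_pos (by linarith)]
    module
  · rw [Real.sign_of_pos (by norm_num), flux_three]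
    norm_num
  rw [flux_of_three_le h.le, Real.sign_of_neg (show 3 - c < 0 by linarith),
    abs_of_neg (show 3 - c < 0 by linarith)]
  rcases lt_trichotomy c 4 with h' | rfl | h'
  · rw [Real.sign_of_pos (by linarith), abs_of_pos (by linarith)]
    module
  · norm_num
  · rw [Real.sign_of_neg (by linarith), abs_of_neg (by linarith)]
    module

theorem entropyFlux_two (c : ℝ) :
    Real.sign (2 - c) • (flux 2 - flux c) =
      Real.sign (3 - c) • (flux 3 - flux c) + (|2 - c| - |3 - c|) • axisVector 0 := by
  rw [flux_three, flux_two]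
  rcases lt_trichotomy 3 c with h | rfl | h
  · rw [Real.sign_of_neg (by linarith), Real.sign_of_neg (by linarith), abs_of_neg (by linarith),
      abs_of_neg (by linarith)]
    module
  · rw [Real.sign_of_neg (by norm_num), flux_three]
    norm_num
  rw [Real.sign_of_pos (show 0 < 3 - c by linarith), abs_of_pos (show 0 < 3 - c by linarith)]
  rcases lt_trichotomy c 2 with h' | rfl | h'
  · rw [Real.sign_of_pos (by linarith), abs_of_pos (by linarith)]
    module
  · rw [flux_two]; norm_num
  · rw [Real.sign_of_neg (by linarith), abs_of_neg (by linarith), flux_of_mem_two_three h'.le h.le]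
    module

/-! ### Push-forward of Lebesgue measure, the flow, entropy and weak solutions -/

/-- A smooth function with compact support, as a test function concentrated near the time `t`. -/
theorem exists_isTestFunction_slice {ψ : Space 2 → ℝ} (hψ : ContDiff ℝ (⊤ : ℕ∞) ψ)
    (hc : HasCompactSupport ψ) (t : ℝ) :
    ∃ φ : ℝ × Space 2 → ℝ, IsTestFunction φ ∧ ∀ x, φ (t, x) = ψ x := by
  let χ : ContDiffBump t := ⟨1, 2, one_pos, one_lt_two⟩
  refine ⟨fun p => χ p.1 * ψ p.2, ⟨?_, ?_⟩, fun x => ?_⟩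
  · exact (χ.contDiff.comp contDiff_fst).mul (hψ.comp contDiff_snd)
  · refine HasCompactSupport.intro (χ.hasCompactSupport.isCompact.prod hc.isCompact)
      fun p hp => ?_
    rw [mem_prod, not_and_or] at hp
    rcases hp with h | h
    · rw [image_eq_zero_of_notMem_tsupport h, zero_mul]
    · rw [image_eq_zero_of_notMem_tsupport h, mul_zero]
  · simp only
    rw [χ.one_of_mem_closedBall (Metric.mem_closedBall_self zero_le_one), one_mul]

/-- The indicator function of a bounded open set is an increasing limit of smooth functions with
compact support. -/
theorem exists_smooth_approx_indicator {U : Set (Space 2)} (hU : IsOpen U)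
    (hb : Bornology.IsBounded U) : ∃ ψ : ℕ → Space 2 → ℝ,
      (∀ k, ContDiff ℝ (⊤ : ℕ∞) (ψ k)) ∧ (∀ k, HasCompactSupport (ψ k)) ∧ (∀ k x, 0 ≤ ψ k x) ∧
      (∀ x, Monotone fun k => ψ k x) ∧
      ∀ x, Tendsto (fun k => ψ k x) atTop (𝓝 (U.indicator 1 x)) := by
  obtain ⟨f, hf, hsm, hr⟩ := hU.exists_contDiff_support_eq (n := ⊤)
  have hf0 : ∀ x, 0 ≤ f x := fun x => (hr ⟨x, rfl⟩ : f x ∈ Icc (0 : ℝ) 1).1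
  have hzero : ∀ x, x ∉ U → f x = 0 := fun x hx => by
    rwa [← hf, Function.notMem_support] at hx
  have hcf : HasCompactSupport f := by
    rw [HasCompactSupport, tsupport, hf]
    exact hb.isCompact_closure
  -- Here f is smooth and vanishes exactly outside U; the k-th function is 0 where f = 0 and equals
  -- 1 as soon as k f ≥ 1.
  refine ⟨fun k x => Real.smoothTransition (k * f x), fun k => ?_, fun k => ?_, fun k x =>
    Real.smoothTransition.nonneg _, fun x k l hkl => ?_, fun x => ?_⟩
  · exact Real.smoothTransition.contDiff.comp (contDiff_const.mul hsm)
  · refine hcf.comp_left (g := fun y => Real.smoothTransition (k * y)) ?_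
    simp
  · refine Real.smoothTransition.monotone ?_
    have : (k : ℝ) ≤ l := by exact_mod_cast hkl
    gcongr
    exact hf0 x
  · by_cases hx : x ∈ U
    · have hpos : 0 < f x := lt_of_le_of_ne (hf0 x) fun h => by
        rw [← hf] at hx
        exact hx h.symm
      rw [indicator_of_mem hx]
      obtain ⟨K, hK⟩ := exists_nat_ge (1 / f x)
      refine tendsto_const_nhds.congr' ((eventually_ge_atTop K).mono fun k hk => ?_)
      refine (Real.smoothTransition.one_of_one_le ?_).symm
      rw [div_le_iff₀ hpos] at hK
      refine hK.trans ?_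
      have : (K : ℝ) ≤ k := by exact_mod_cast hk
      gcongr
    · simp [indicator_of_notMem hx, hzero x hx]

namespace ShearSystem

variable (S : ShearSystem) {N : ℕ} {φ : ℝ × Space 2 → ℝ}

theorem measurable_densityAt (N : ℕ) (t : ℝ) : Measurable (S.densityAt N t) :=
  (S.measurable_density_time N).comp measurable_prodMk_left

theorem densityAt_pos (N : ℕ) (t : ℝ) (x : Space 2) : 0 < S.densityAt N t x :=
  two_pos.trans_le (S.density_mem N _ x).1

theorem densityAt_smul (N : ℕ) (t : ℝ) (x : Space 2) :
    S.densityAt N t x • ((1 : ℝ), S.field N t x) =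
      (3 + 1 * S.phase N 1 t x + -1 * S.phase N 0 t x,
        0 + (1 * S.phase N 1 t x) • axisVector 1 + (-1 * S.phase N 0 t x) • axisVector 0) := by
  have hf : S.densityAt N t x • S.field N t x = flux (S.densityAt N t x) := smul_velocity _
  rw [Prod.smul_mk, hf]
  rcases S.densityAt_cases N t x with ⟨h, h1, h0⟩ | ⟨h, h1, h0⟩ | ⟨h, h1, h0⟩ <;> rw [h, h1, h0]
  · rw [flux_four]; norm_num
  · rw [flux_two]; norm_num
  · rw [flux_three]; norm_num

theorem densityAt_eq (N : ℕ) (t : ℝ) (x : Space 2) :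
    S.densityAt N t x = 3 + 1 * S.phase N 1 t x + -1 * S.phase N 0 t x := by
  simpa using congrArg Prod.fst (S.densityAt_smul N t x)

/-- The integral of ρ (φ_t + f·∇φ) over times after t is evaluated twice: along trajectories, with
transported function 1, and along the moving phases. The two boundary terms must agree. -/
theorem integral_place (hN : 0 < N) (hφ : IsTestFunction φ) (t : ℝ) :
    3 * ∫ z, φ (t, S.place N t z) = ∫ x, S.densityAt N t x * φ (t, x) := by
  have h1 := S.integral_label_transport hN hφ (g := fun _ => (1 : ℝ))
    stronglyMeasurable_const (M := 1) (by simp) t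
  have h2 := S.integral_phases N hφ 3 1 (-1) 0 t
  simp only [← densityAt_smul, map_smul] at h2
  simp only [smul_eq_mul, mul_one, ← densityAt_eq] at h1 h2
  rw [h1, neg_inj, integral_const_mul] at h2
  exact h2

/-- The measure with density `S.densityAt N t`. -/
def massAt (N : ℕ) (t : ℝ) : Measure (Space 2) :=
  volume.withDensity fun x => ENNReal.ofReal (S.densityAt N t x)

theorem lintegral_place (hN : 0 < N) {ψ : Space 2 → ℝ} (hψ : ContDiff ℝ (⊤ : ℕ∞) ψ)
    (hc : HasCompactSupport ψ) (h0 : ∀ x, 0 ≤ ψ x) (t : ℝ) :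
    ∫⁻ x, ENNReal.ofReal (ψ x) ∂((3 : ENNReal) • volume).map (S.place N t) =
      ∫⁻ x, ENNReal.ofReal (ψ x) ∂S.massAt N t := by
  have hm : Measurable fun x => ENNReal.ofReal (ψ x) := hψ.continuous.measurable.ennreal_ofReal
  obtain ⟨φ, hφ, hφψ⟩ := exists_isTestFunction_slice hψ hc t
  have key := S.integral_place hN hφ t
  simp only [hφψ] at key
  have hnn : ∀ x, 0 ≤ S.densityAt N t x * ψ x := fun x =>
    mul_nonneg (S.densityAt_pos N t x).le (h0 x)
  have hint : Integrable fun x => S.densityAt N t x * ψ x :=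
    (hψ.continuous.integrable_of_hasCompactSupport hc).bdd_mul
      (S.measurable_densityAt N t).aestronglyMeasurable
      (ae_of_all _ fun x => S.norm_density_le N _ _)
  rw [lintegral_map hm (S.measurable_place hN t), lintegral_smul_measure, massAt,
    lintegral_withDensity_eq_lintegral_mul _ (S.measurable_densityAt N t).ennreal_ofReal hm]
  simp only [Pi.mul_apply, ← ENNReal.ofReal_mul (S.densityAt_pos N t _).le]
  rw [← ofReal_integral_eq_lintegral_ofReal hint (ae_of_all _ hnn)]
  by_cases hz : ∀ x, ψ x = 0
  · simp [hz]
  push Not at hz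
  obtain ⟨x₀, hx₀⟩ := hz
  -- A non-integrable function has Bochner integral 0, so positivity of the right-hand integral
  -- forces ψ ∘ `place` to be integrable.
  have hpos : 0 < ∫ x, S.densityAt N t x * ψ x := by
    rw [integral_pos_iff_support_of_nonneg hnn hint]
    have : Function.support (fun x => S.densityAt N t x * ψ x) = Function.support ψ := by
      ext x
      simp [(S.densityAt_pos N t x).ne']
    rw [this]
    exact (hψ.continuous.isOpen_support).measure_pos _ ⟨x₀, hx₀⟩
  have hne : ∫ z, ψ (S.place N t z) ≠ 0 := fun h => by
    rw [h] at key
    linarith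
  have hint' : Integrable fun z => ψ (S.place N t z) := by
    by_contra h
    exact hne (integral_undef h)
  rw [← ofReal_integral_eq_lintegral_ofReal hint' (ae_of_all _ fun z => h0 _), ← key,
    ENNReal.ofReal_mul (by norm_num)]
  simp

/-- Equality on smooth nonnegative test functions passes by monotone approximation to bounded open
sets, and these determine locally finite measures here. -/
theorem map_place (hN : 0 < N) (t : ℝ) :
    ((3 : ENNReal) • volume).map (S.place N t) = S.massAt N t := by
  have hle : S.massAt N t ≤ (4 : ENNReal) • volume := by
    rw [← withDensity_const]
    refine withDensity_mono (ae_of_all _ fun x => ?_)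
    exact (ENNReal.ofReal_le_ofReal (S.density_mem N _ x).2).trans_eq (by simp)
  have hopen : ∀ U, IsOpen U → Bornology.IsBounded U →
      ((3 : ENNReal) • volume).map (S.place N t) U = S.massAt N t U := by
    intro U hU hb
    obtain ⟨ψ, hsm, hc, h0, hmono, hlim⟩ := exists_smooth_approx_indicator hU hb
    have hlim' : ∀ μ : Measure (Space 2), Tendsto (fun k => ∫⁻ x, ENNReal.ofReal (ψ k x) ∂μ) atTop
        (𝓝 (μ U)) := by
      intro μ
      rw [← lintegral_indicator_one hU.measurableSet]
      refine lintegral_tendsto_of_tendsto_of_monotone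
        (fun k => (hsm k).continuous.measurable.ennreal_ofReal.aemeasurable)
        (ae_of_all _ fun x k l hkl => ENNReal.ofReal_le_ofReal (hmono x hkl))
        (ae_of_all _ fun x => ?_)
      convert ENNReal.tendsto_ofReal (hlim x) using 2
      by_cases hx : x ∈ U <;> simp [hx]
    refine tendsto_nhds_unique (hlim' _) ?_
    simp only [S.lintegral_place hN (hsm _) (hc _) (h0 _)]
    exact hlim' _
  have hfin : ∀ x, S.massAt N t (Metric.ball x 1) < ⊤ := fun x =>
    (hle _).trans_lt (by
      rw [Measure.smul_apply, smul_eq_mul]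
      exact ENNReal.mul_lt_top (by simp) measure_ball_lt_top)
  have : IsLocallyFiniteMeasure (S.massAt N t) :=
    ⟨fun x => ⟨Metric.ball x 1, Metric.ball_mem_nhds x one_pos, hfin x⟩⟩
  have : IsLocallyFiniteMeasure (((3 : ENNReal) • volume).map (S.place N t)) :=
    ⟨fun x => ⟨Metric.ball x 1, Metric.ball_mem_nhds x one_pos, by
      rw [hopen _ Metric.isOpen_ball Metric.isBounded_ball]; exact hfin x⟩⟩
  exact Measure.OuterRegular.ext_isOpen_isBounded hopen

theorem three_mul_volume_preimage_place (hN : 0 < N) (t : ℝ) {s : Set (Space 2)}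
    (hs : MeasurableSet s) : 3 * volume (S.place N t ⁻¹' s) = S.massAt N t s := by
  rw [← S.map_place hN t, Measure.map_apply (S.measurable_place hN t) hs, Measure.smul_apply,
    smul_eq_mul]

theorem quasiMeasurePreserving_place (hN : 0 < N) (t : ℝ) :
    Measure.QuasiMeasurePreserving (S.place N t) volume volume := by
  refine ⟨S.measurable_place hN t, Measure.AbsolutelyContinuous.mk fun s hs h => ?_⟩
  have := S.three_mul_volume_preimage_place hN t hs
  rw [massAt, withDensity_absolutelyContinuous _ _ h] at this
  rw [Measure.map_apply (S.measurable_place hN t) hs]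
  simpa using this

/-- Positivity of the density makes Lebesgue measure absolutely continuous with respect to the mass
measure; this is the direction needed for the inverse map. -/
theorem quasiMeasurePreserving_label (hN : 0 < N) (t : ℝ) :
    Measure.QuasiMeasurePreserving (S.label N t) volume volume := by
  refine ⟨S.measurable_label N t, Measure.AbsolutelyContinuous.mk fun s hs h => ?_⟩
  rw [Measure.map_apply (S.measurable_label N t) hs]
  have h1 := S.three_mul_volume_preimage_place hN t (S.measurable_label N t hs)
  have h2 : S.place N t ⁻¹' (S.label N t ⁻¹' s) = s := by
    ext z
    simp [S.label_place hN]
  rw [h2, h, mul_zero] at h1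
  refine (withDensity_absolutelyContinuous' (S.measurable_densityAt N t).ennreal_ofReal.aemeasurable
    (ae_of_all _ fun x => ?_)) h1.symm
  simpa using S.densityAt_pos N t x

theorem isFlow (hN : 0 < N) : IsFlow (S.field N) (fun t y => S.place N t (S.label N 0 y))
    (fun t x => S.place N 0 (S.label N t x)) where
  trajectory := ae_of_all _ fun y => S.isTrajectory_place hN y
  unique := ae_of_all _ fun _ _ hξ _ ht => S.trajectory_unique hN hξ ht
  forward t _ := (S.quasiMeasurePreserving_place hN t).comp (S.quasiMeasurePreserving_label hN 0)
  backward t _ := (S.quasiMeasurePreserving_place hN 0).comp (S.quasiMeasurePreserving_label hN t)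
  left_inv t _ := ae_of_all _ fun y => by
    simp only [S.label_place hN, S.place_label hN]
  right_inv t _ := ae_of_all _ fun x => by
    simp only [S.label_place hN, S.place_label hN]

theorem setIntegral_Ioi_prod_univ {E : Type*} [NormedAddCommGroup E] [NormedSpace ℝ E]
    {F : ℝ × Space 2 → E} (hF : Integrable F) (t₀ : ℝ) :
    ∫ p in Ioi t₀ ×ˢ univ, F p = ∫ t in Ioi t₀, ∫ x, F (t, x) := by
  rw [Measure.volume_eq_prod, setIntegral_prod _ hF.integrableOn]
  simp only [Measure.restrict_univ]

/-- Each Kruzhkov pair is affine in the two phase indicators with the matching velocities, so the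
entropy inequality holds with equality. -/
theorem isEntropySolution (N : ℕ) :
    IsEntropySolution (fun r => r • velocity r) (S.densityAt N 0) (S.densityAt N) where
  bounded := ⟨(S.measurable_density_time N).aestronglyMeasurable,
    4, ae_of_all _ fun p => S.norm_density_le N _ _⟩
  entropy c φ hφ _ := by
    have hpair : ∀ t x, ((|S.densityAt N t x - c|, Real.sign (S.densityAt N t x - c) •
        (flux (S.densityAt N t x) - flux c)) : ℝ × Space 2) =
        (|3 - c| + (|4 - c| - |3 - c|) * S.phase N 1 t x + (|2 - c| - |3 - c|) * S.phase N 0 t x,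
          Real.sign (3 - c) • (flux 3 - flux c) +
          ((|4 - c| - |3 - c|) * S.phase N 1 t x) • axisVector 1 +
          ((|2 - c| - |3 - c|) * S.phase N 0 t x) • axisVector 0) := by
      intro t x
      rcases S.densityAt_cases N t x with ⟨h, h1, h0⟩ | ⟨h, h1, h0⟩ | ⟨h, h1, h0⟩ <;>
        rw [h, h1, h0]
      · rw [entropyFlux_four]; simp
      · rw [entropyFlux_two]; simp
      · simp
    have habs : ∀ x, |S.densityAt N 0 x - c| = |3 - c| + (|4 - c| - |3 - c|) * S.phase N 1 0 x +
        (|2 - c| - |3 - c|) * S.phase N 0 0 x := fun x => congrArg Prod.fst (hpair 0 x)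
    have := S.integral_phases N hφ |3 - c| (|4 - c| - |3 - c|) (|2 - c| - |3 - c|)
      (Real.sign (3 - c) • (flux 3 - flux c)) 0
    rw [setIntegral_Ioi_prod_univ (S.integrable_phases N hφ _ _ _ _)] at this
    simp only [smul_velocity, hpair, habs]
    simp only at this
    rw [this]
    simp

theorem isWeakSolution_aux (hN : 0 < N) (hφ : IsTestFunction φ) {θ : Space 2 → Space 2}
    (hθ : Measurable θ) {M : ℝ} (hM : ∀ x, ‖θ x‖ ≤ M) :
    (∫ t in Ioi (0 : ℝ), ∫ x, (fderiv ℝ φ (t, x) (1, S.field N t x)) •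
      (S.densityAt N t x • θ (S.place N 0 (S.label N t x)))) +
      ∫ x, φ (0, x) • (S.densityAt N 0 x • θ x) = 0 := by
  have hg : StronglyMeasurable fun z => θ (S.place N 0 z) :=
    (hθ.comp (S.measurable_place hN 0)).stronglyMeasurable
  have h1 := S.integral_label_transport hN hφ hg (fun z => hM _) 0
  rw [setIntegral_Ioi_prod_univ (S.integrable_label_transport N hφ hg (fun z => hM _))] at h1
  simp only [smul_smul, mul_comm (fderiv ℝ φ _ _)]
  simp only at h1
  rw [h1]
  -- Passing from labels to initial positions turns 3 dz into ρ(0, x) dx, so the boundary term is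
  -- exactly the initial datum.
  have h2 := (S.measurableEmbedding_place hN 0).integral_map (μ := (3 : ENNReal) • volume)
    (fun x => φ (0, x) • θ x)
  rw [S.map_place hN, massAt, integral_withDensity_eq_integral_toReal_smul
    (S.measurable_densityAt N 0).ennreal_ofReal (by simp), integral_smul_measure] at h2
  simp only [ENNReal.toReal_ofReal (S.densityAt_pos N 0 _).le, smul_smul, ENNReal.toReal_ofNat] at h2
  simp only [mul_comm (φ _) (S.densityAt _ _ _), h2, mul_smul (3 : ℝ), integral_smul]
  simp

end ShearSystem

/-! ### The concrete arrays and their identification with the rectangles -/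

/-- The arrays alternate cyclically between three shapes; only the second moves to the right. -/
def arrayAxis (m : ℕ) : Fin 2 := if m % 3 = 1 then 0 else 1

/-- The position of the front of the `m`-th array, before scaling. -/
def arrayTop (m : ℕ) : ℝ := if m % 3 = 0 then 31 else if m % 3 = 1 then 25 else 37 / 2

/-- The length of the rectangles of the `m`-th array, before scaling. -/
def arrayLength (m : ℕ) : ℝ := if m % 3 = 2 then 3 / 2 else 3

/-- The transverse offset of the `m`-th array, before scaling. -/
def arrayOffset (m : ℕ) : ℝ := if m % 3 = 1 then 1 / 2 else 0

/-- The index of the column (or row) of the `m`-th array with transverse coordinate `p`. -/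
def arrayIndex (m : ℕ) (p : ℝ) : ℤ := ⌊(2 : ℝ) ^ (m / 3) * p - arrayOffset m⌋

open Classical in
/-- The length of the rectangle of the `m`-th array with transverse coordinate `p`. -/
def arrayExtent (m : ℕ) (p : ℝ) : ℝ :=
  if Even (arrayIndex m p) then arrayLength m / 2 ^ (m / 3) else 0

/-- The value of `t - x₁ - x₂` at which points with transverse coordinate `p` enter the `m`-th
array. -/
def arrayEnter (m : ℕ) (p : ℝ) : ℝ :=
  -p - (arrayTop m - arrayIndex m p) / 2 ^ (m / 3)

theorem exists_mod_three (m : ℕ) : ∃ k, m = 3 * k ∨ m = 3 * k + 1 ∨ m = 3 * k + 2 :=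
  ⟨m / 3, by omega⟩

theorem arrayLength_pos (m : ℕ) : 0 < arrayLength m := by
  unfold arrayLength; split_ifs <;> norm_num

theorem arrayExtent_nonneg (m : ℕ) (p : ℝ) : 0 ≤ arrayExtent m p := by
  unfold arrayExtent
  have := arrayLength_pos m
  split_ifs <;> positivity

theorem measurable_arrayIndex (m : ℕ) : Measurable (arrayIndex m) :=
  Int.measurable_floor.comp (by fun_prop)

/-- The system of all the arrays of rectangles. -/
def arrays : ShearSystem where
  axis := arrayAxis
  enter := arrayEnter
  exit m p := arrayEnter m p + arrayExtent m p
  -- After scaling, the entry value is -(top + offset) minus the fractional part used in the index,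
  -- which lies in [0, 1).
  lo m := -(arrayTop m + arrayOffset m + 1) / 2 ^ (m / 3)
  hi m := (-(arrayTop m + arrayOffset m) + arrayLength m) / 2 ^ (m / 3)
  measurable_enter m := by
    have : Measurable fun p => (arrayIndex m p : ℝ) :=
      (measurable_of_countable _).comp (measurable_arrayIndex m)
    unfold arrayEnter
    fun_prop
  measurable_exit m := by
    have h1 : Measurable fun p => (arrayIndex m p : ℝ) :=
      (measurable_of_countable _).comp (measurable_arrayIndex m)
    have h2 : Measurable (arrayExtent m) :=
      Measurable.ite (measurable_arrayIndex m (MeasurableSet.of_discrete (s := {i : ℤ | Even i})))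
        measurable_const measurable_const
    unfold arrayEnter
    fun_prop
  enter_le_exit m p := le_add_of_nonneg_right (arrayExtent_nonneg m p)
  lo_le_enter m p := by
    have := Int.sub_one_lt_floor ((2 : ℝ) ^ (m / 3) * p - arrayOffset m)
    rw [arrayEnter, arrayIndex, div_le_iff₀ (by positivity), sub_mul,
      div_mul_cancel₀ _ (by positivity)]
    linarith
  exit_le_hi m p := by
    have h1 := Int.floor_le ((2 : ℝ) ^ (m / 3) * p - arrayOffset m)
    have h2 : arrayExtent m p ≤ arrayLength m / 2 ^ (m / 3) := by
      have := arrayLength_pos m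
      unfold arrayExtent
      split_ifs
      · exact le_rfl
      · positivity
    have h3 : arrayEnter m p ≤ -(arrayTop m + arrayOffset m) / 2 ^ (m / 3) := by
      rw [arrayEnter, arrayIndex, le_div_iff₀ (by positivity), sub_mul,
        div_mul_cancel₀ _ (by positivity)]
      linarith
    rw [add_div]
    exact add_le_add h3 h2
  -- In units of 2^{-k} the three windows are [-32, -28], [-53/2, -45/2] and [-39/2, -17]; the next
  -- level begins at -16.
  hi_lt_lo m := by
    have hp : ∀ k : ℕ, (0 : ℝ) < 2 ^ k := fun k => by positivity
    obtain ⟨k, rfl | rfl | rfl⟩ := exists_mod_three m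
    · have e1 : 3 * k / 3 = k := by omega
      have e2 : (3 * k + 1) / 3 = k := by omega
      have e3 : 3 * k % 3 = 0 := by omega
      have e4 : (3 * k + 1) % 3 = 1 := by omega
      simp only [arrayTop, arrayOffset, arrayLength, e1, e2, e3, e4]
      norm_num
      rw [div_lt_div_iff_of_pos_right (hp k)]
      norm_num
    · have e1 : (3 * k + 1) / 3 = k := by omega
      have e2 : (3 * k + 1 + 1) / 3 = k := by omega
      have e3 : (3 * k + 1) % 3 = 1 := by omega
      have e4 : (3 * k + 1 + 1) % 3 = 2 := by omega
      simp only [arrayTop, arrayOffset, arrayLength, e1, e2, e3, e4]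
      norm_num
      rw [div_lt_div_iff_of_pos_right (hp k)]
      norm_num
    · have e1 : (3 * k + 2) / 3 = k := by omega
      have e2 : (3 * k + 2 + 1) / 3 = k + 1 := by omega
      have e3 : (3 * k + 2) % 3 = 2 := by omega
      have e4 : (3 * k + 2 + 1) % 3 = 0 := by omega
      simp only [arrayTop, arrayOffset, arrayLength, e1, e2, e3, e4]
      norm_num
      rw [pow_succ, div_lt_div_iff₀ (hp k) (mul_pos (hp k) two_pos)]
      nlinarith [hp k]

theorem arrays_hi_neg (m : ℕ) : arrays.hi m < 0 := by
  refine div_neg_of_neg_of_pos ?_ (by positivity)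
  unfold arrayTop arrayOffset arrayLength
  obtain ⟨k, rfl | rfl | rfl⟩ := exists_mod_three m
  · have e : 3 * k % 3 = 0 := by omega
    norm_num [e]
  · have e : (3 * k + 1) % 3 = 1 := by omega
    norm_num [e]
  · have e : (3 * k + 2) % 3 = 2 := by omega
    norm_num [e]

/-- The quantity -σ - p is the longitudinal coordinate in the frame of the array. The sign change
turns intervals of σ open on the left into the rectangles' sides open on the right; for odd indices
the interval is empty. -/
theorem arrays_isActive_iff (m : ℕ) (σ : ℝ) (x : Space 2) :
    arrays.IsActive m σ x ↔ ∃ j : ℤ,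
      (2 : ℝ) ^ (m / 3) * x (1 - arrayAxis m) ∈
        Ico (2 * j + arrayOffset m) (2 * j + arrayOffset m + 1) ∧
      (2 : ℝ) ^ (m / 3) * (-σ - x (1 - arrayAxis m)) ∈
        Ico (arrayTop m - arrayLength m - 2 * j) (arrayTop m - 2 * j) := by
  have hK : (0 : ℝ) < 2 ^ (m / 3) := by positivity
  rw [ShearSystem.IsActive]
  change σ ∈ Ioc (arrayEnter m (x (1 - arrayAxis m)))
    (arrayEnter m (x (1 - arrayAxis m)) + arrayExtent m (x (1 - arrayAxis m))) ↔ _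
  generalize x (1 - arrayAxis m) = p
  have hidx : ∀ j : ℤ, (2 : ℝ) ^ (m / 3) * p ∈
      Ico (2 * j + arrayOffset m) (2 * j + arrayOffset m + 1) ↔ arrayIndex m p = 2 * j := by
    intro j
    rw [arrayIndex, Int.floor_eq_iff, mem_Ico]
    push_cast
    constructor <;> rintro ⟨h1, h2⟩ <;> constructor <;> linarith
  simp only [hidx]
  by_cases he : Even (arrayIndex m p)
  · obtain ⟨j, hj⟩ := even_iff_exists_two_mul.1 he
    have : σ ∈ Ioc (arrayEnter m p) (arrayEnter m p + arrayExtent m p) ↔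
        (2 : ℝ) ^ (m / 3) * (-σ - p) ∈
          Ico (arrayTop m - arrayLength m - 2 * j) (arrayTop m - 2 * j) := by
      rw [arrayExtent, if_pos he, arrayEnter, hj, mem_Ioc, mem_Ico]
      push_cast
      have e : -p - (arrayTop m - 2 * j) / 2 ^ (m / 3) + arrayLength m / 2 ^ (m / 3) =
        -p - (arrayTop m - arrayLength m - 2 * j) / 2 ^ (m / 3) := by ring
      rw [e, and_comm, sub_lt_comm, lt_div_iff₀ hK, le_sub_comm, div_le_iff₀ hK]
      constructor <;> rintro ⟨h1, h2⟩ <;> constructor <;> linarith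
    rw [this]
    refine ⟨fun h => ⟨j, hj, h⟩, fun ⟨i, hi, h⟩ => ?_⟩
    have : i = j := by omega
    rwa [this] at h
  · rw [arrayExtent, if_neg he, add_zero, Ioc_self]
    refine iff_of_false (notMem_empty _) fun ⟨i, hi, _⟩ => he ?_
    rw [hi]
    exact even_two_mul i

theorem sub_smul_mem_QSharp (k : ℕ) (t : ℝ) (x : Space 2) :
    x - t • (!₂[0, 1] : Space 2) ∈ QSharp k ↔ arrays.IsActive (3 * k) (t - (x 0 + x 1)) x := by
  have e1 : 3 * k / 3 = k := by omega
  have e3 : 3 * k % 3 = 0 := by omega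
  rw [arrays_isActive_iff]
  refine exists_congr fun j => ?_
  have e : x 0 + x 1 - t - x 0 = x 1 - t := by ring
  have e' : (31 - 3 - 2 * j : ℝ) = 28 - 2 * j := by ring
  simp only [arrayTop, arrayLength, arrayOffset, arrayAxis, e1, e3]
  norm_num [e, e']

theorem sub_smul_mem_QFlat (k : ℕ) (t : ℝ) (x : Space 2) :
    x - t • (!₂[1, 0] : Space 2) ∈ QFlat k ↔ arrays.IsActive (3 * k + 1) (t - (x 0 + x 1)) x := by
  have e1 : (3 * k + 1) / 3 = k := by omega
  have e3 : (3 * k + 1) % 3 = 1 := by omega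
  rw [arrays_isActive_iff]
  refine exists_congr fun j => ?_
  have e : x 0 + x 1 - t - x 1 = x 0 - t := by ring
  have e' : (2 * j + 1 / 2 + 1 : ℝ) = 2 * j + 3 / 2 := by ring
  have e'' : (25 - 3 - 2 * j : ℝ) = 22 - 2 * j := by ring
  simp only [arrayTop, arrayLength, arrayOffset, arrayAxis, e1, e3]
  norm_num [e, e', e'']
  tauto

theorem sub_smul_mem_QTilde (k : ℕ) (t : ℝ) (x : Space 2) :
    x - t • (!₂[0, 1] : Space 2) ∈ QTilde k ↔ arrays.IsActive (3 * k + 2) (t - (x 0 + x 1)) x := by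
  have e1 : (3 * k + 2) / 3 = k := by omega
  have e3 : (3 * k + 2) % 3 = 2 := by omega
  rw [arrays_isActive_iff]
  refine exists_congr fun j => ?_
  have e : x 0 + x 1 - t - x 0 = x 1 - t := by ring
  have e' : (17 - 2 * j + 3 / 2 : ℝ) = 37 / 2 - 2 * j := by ring
  simp only [arrayTop, arrayLength, arrayOffset, arrayAxis, e1, e3]
  norm_num [e, e']

/-- Level k consists of the arrays 3k, 3k + 1 and 3k + 2, so levels 0 to n are the first 3 (n + 1)
arrays. -/
theorem rho_eq_densityAt (n : ℕ) : rho n = arrays.densityAt (3 * (n + 1)) := by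
  classical
  funext t x
  have h1 : (∃ k ≤ n, x - t • (!₂[0, 1] : Space 2) ∈ QSharp k ∪ QTilde k) ↔
      ∃ m < 3 * (n + 1), arrays.axis m = 1 ∧ arrays.IsActive m (t - (x 0 + x 1)) x := by
    simp only [mem_union, sub_smul_mem_QSharp, sub_smul_mem_QTilde]
    constructor
    · rintro ⟨k, hk, h | h⟩
      · exact ⟨3 * k, by omega, if_neg (by omega), h⟩
      · exact ⟨3 * k + 2, by omega, if_neg (by omega), h⟩
    · rintro ⟨m, hm, ha, h⟩
      obtain ⟨k, rfl | rfl | rfl⟩ := exists_mod_three m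
      · exact ⟨k, by omega, Or.inl h⟩
      · exact absurd ((if_pos (by omega : (3 * k + 1) % 3 = 1)).symm.trans ha) (by decide)
      · exact ⟨k, by omega, Or.inr h⟩
  have h0 : (∃ k ≤ n, x - t • (!₂[1, 0] : Space 2) ∈ QFlat k) ↔
      ∃ m < 3 * (n + 1), arrays.axis m = 0 ∧ arrays.IsActive m (t - (x 0 + x 1)) x := by
    simp only [sub_smul_mem_QFlat]
    constructor
    · rintro ⟨k, hk, h⟩
      exact ⟨3 * k + 1, by omega, if_pos (by omega), h⟩
    · rintro ⟨m, hm, ha, h⟩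
      obtain ⟨k, rfl | rfl | rfl⟩ := exists_mod_three m
      · exact absurd ((if_neg (by omega : ¬ (3 * k) % 3 = 1)).symm.trans ha) (by decide)
      · exact ⟨k, by omega, h⟩
      · exact absurd ((if_neg (by omega : ¬ (3 * k + 2) % 3 = 1)).symm.trans ha) (by decide)
  rw [rho, ShearSystem.densityAt, ShearSystem.density, if_congr h1 rfl rfl, if_congr h0 rfl rfl]

/-! ### Combinatorics of the stripes -/

theorem floor_half (y : ℝ) : ⌊y / 2⌋ = ⌊y⌋ / 2 := by
  have h1 := Int.floor_le y
  have h2 := Int.lt_floor_add_one y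
  have h3 : 2 * (⌊y⌋ / 2) ≤ ⌊y⌋ := by omega
  have h4 : ⌊y⌋ + 1 ≤ 2 * (⌊y⌋ / 2) + 2 := by omega
  have h3' : (2 : ℝ) * ((⌊y⌋ / 2 : ℤ) : ℝ) ≤ ⌊y⌋ := by exact_mod_cast h3
  have h4' : (⌊y⌋ : ℝ) + 1 ≤ 2 * ((⌊y⌋ / 2 : ℤ) : ℝ) + 2 := by exact_mod_cast h4
  rw [Int.floor_eq_iff]
  constructor <;> linarith

open Classical in
/-- The combinatorics of three consecutive arrays: horizontal stripes of width `1` are turned into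
horizontal stripes of width `1/2`. -/
theorem stripes_halved {a b a' b' b'' : ℝ} (hb' : b' = b + if Even ⌊a⌋ then 1 else 0)
    (ha' : a' = a - if Even ⌊b' - 1 / 2⌋ then 1 else 0)
    (hb'' : b'' = b' + if Even ⌊a'⌋ then 1 / 2 else 0) :
    (Even ⌊2 * b''⌋ ↔ Even ⌊b⌋) ∧ ⌊a'⌋ + ⌊b''⌋ ≤ 2 * ⌊a / 2⌋ + 2 * ⌊b / 2⌋ + 2 := by
  -- Horizontal moves are by units and vertical ones by half-units, so everything depends on ⌊a⌋ and
  -- ⌊2b⌋ only and becomes integer arithmetic with parities.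
  have f0 : ∀ y : ℝ, ⌊y⌋ = ⌊2 * y⌋ / 2 := fun y => by
    rw [← floor_half]; ring_nf
  have h1 : ⌊2 * b'⌋ = ⌊2 * b⌋ + if Even ⌊a⌋ then 2 else 0 := by
    rw [hb', mul_add, ← Int.floor_add_intCast]
    split_ifs <;> simp
  have h2 : ⌊b' - 1 / 2⌋ = (⌊2 * b'⌋ - 1) / 2 := by
    rw [f0, mul_sub, ← Int.floor_sub_one]; norm_num
  have h3 : ⌊a'⌋ = ⌊a⌋ - if Even ⌊b' - 1 / 2⌋ then 1 else 0 := by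
    rw [ha', ← Int.floor_sub_intCast]
    split_ifs <;> simp
  have h4 : ⌊2 * b''⌋ = ⌊2 * b'⌋ + if Even ⌊a'⌋ then 1 else 0 := by
    rw [hb'', mul_add, ← Int.floor_add_intCast]
    split_ifs <;> simp
  rw [f0 b'', f0 b, floor_half a, floor_half b, f0 b]
  rw [h2] at h3
  generalize ⌊2 * b''⌋ = j'' at *
  generalize ⌊2 * b'⌋ = j' at *
  generalize ⌊2 * b⌋ = j at *
  generalize ⌊a'⌋ = i' at *
  generalize ⌊a⌋ = i at *
  clear f0 h2 hb' ha' hb''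
  simp only [Int.even_iff] at *
  split_ifs at h1 h3 h4 <;> omega

open Classical in
theorem arrays_shift_total (m : ℕ) (x : Space 2) :
    arrays.shift m (arrays.hi m) x = shearRate (arrayAxis m) *
      if Even (arrayIndex m (x (1 - arrayAxis m))) then arrayLength m / 2 ^ (m / 3) else 0 := by
  rw [ShearSystem.shift, ramp_of_ge (arrays.enter_le_exit m _) (arrays.exit_le_hi m _)]
  change _ * (arrayEnter m _ + arrayExtent m _ - arrayEnter m _) = _
  rw [add_sub_cancel_left]
  rfl

open Classical in
-- One third of the lengths 3, 3, 3/2 gives the displacements 1, -1, 1/2 in units of 2^{-k}. The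
-- intermediate height b' is the scaled x₂ after the first array.
theorem arrays_total_level (k : ℕ) (z : Space 2) : ∃ b' : ℝ,
    b' = 2 ^ k * arrays.total (3 * k) z 1 +
      (if Even ⌊2 ^ k * arrays.total (3 * k) z 0⌋ then 1 else 0) ∧
    2 ^ k * arrays.total (3 * (k + 1)) z 0 = 2 ^ k * arrays.total (3 * k) z 0 -
      (if Even ⌊b' - 1 / 2⌋ then 1 else 0) ∧
    2 ^ k * arrays.total (3 * (k + 1)) z 1 = b' +
      if Even ⌊2 ^ k * arrays.total (3 * (k + 1)) z 0⌋ then 1 / 2 else 0 := by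
  have hK : (2 : ℝ) ^ k ≠ 0 := by positivity
  set y := arrays.total (3 * k) z with hy
  have d0 : 3 * k / 3 = k := by omega
  have d1 : (3 * k + 1) / 3 = k := by omega
  have d2 : (3 * k + 2) / 3 = k := by omega
  have m0 : 3 * k % 3 = 0 := by omega
  have m1 : (3 * k + 1) % 3 = 1 := by omega
  have m2 : (3 * k + 2) % 3 = 2 := by omega
  have a0 : arrayAxis (3 * k) = 1 := if_neg (by omega)
  have a1 : arrayAxis (3 * k + 1) = 0 := if_pos (by omega)
  have a2 : arrayAxis (3 * k + 2) = 1 := if_neg (by omega)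
  have s0 := arrays.total_succ (3 * k) z
  have s1 := arrays.total_succ (3 * k + 1) z
  have s2 := arrays.total_succ (3 * k + 2) z
  set y₁ := arrays.total (3 * k + 1) z with hy₁
  set y₂ := arrays.total (3 * k + 2) z with hy₂
  have e3 : arrays.total (3 * (k + 1)) z = arrays.total (3 * k + 2 + 1) z := rfl
  rw [e3]
  set y₃ := arrays.total (3 * k + 2 + 1) z with hy₃
  rw [arrays.shear_apply, arrays_shift_total] at s0 s1 s2
  change y₁ = y + _ • axisVector (arrayAxis (3 * k)) at s0
  change y₂ = y₁ + _ • axisVector (arrayAxis (3 * k + 1)) at s1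
  change y₃ = y₂ + _ • axisVector (arrayAxis (3 * k + 2)) at s2
  simp only [a0, a1, a2, arrayIndex, arrayLength, arrayOffset, d0, d1, d2, m0, m1, m2] at s0 s1 s2
  norm_num [shearRate] at s0 s1 s2
  have c01 : y₁ 0 = y 0 := by rw [s0]; split_ifs <;> simp
  have c12 : y₂ 1 = y₁ 1 := by rw [s1]; split_ifs <;> simp
  have c23 : y₃ 0 = y₂ 0 := by rw [s2]; split_ifs <;> simp
  have c0 : y₁ 1 = y 1 + (if Even ⌊2 ^ k * y 0⌋ then 1 else 0) / 2 ^ k := by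
    rw [s0]; (split_ifs <;> simp); ring
  have c1 : y₂ 0 = y₁ 0 - (if Even ⌊2 ^ k * y₁ 1 - 1 / 2⌋ then 1 else 0) / 2 ^ k := by
    rw [s1]; (split_ifs <;> simp); ring
  have c2 : y₃ 1 = y₂ 1 + (if Even ⌊2 ^ k * y₂ 0⌋ then 1 / 2 else 0) / 2 ^ k := by
    rw [s2]; (split_ifs <;> simp); ring
  refine ⟨2 ^ k * y₁ 1, ?_, ?_, ?_⟩
  · rw [c0, mul_add, mul_div_cancel₀ _ hK]
  · rw [c23, c1, mul_sub, mul_div_cancel₀ _ hK, c01]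
  · rw [c2, mul_add, mul_div_cancel₀ _ hK, c12, c23]

/-- Each level halves the width of the stripes and does not increase this upper bound for
`x₁ + x₂`. -/
theorem arrays_level (k : ℕ) (z : Space 2) :
    (Even ⌊2 ^ (k + 1) * arrays.total (3 * (k + 1)) z 1⌋ ↔
      Even ⌊2 ^ k * arrays.total (3 * k) z 1⌋) ∧
    ⌊2 ^ (k + 1) * arrays.total (3 * (k + 1)) z 0 / 2⌋ +
        ⌊2 ^ (k + 1) * arrays.total (3 * (k + 1)) z 1 / 2⌋ + 2 ≤
      2 * (⌊2 ^ k * arrays.total (3 * k) z 0 / 2⌋ + ⌊2 ^ k * arrays.total (3 * k) z 1 / 2⌋ + 2) := by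
  obtain ⟨b', h1, h2, h3⟩ := arrays_total_level k z
  have := stripes_halved h1 h2 h3
  have e : ∀ y : ℝ, 2 ^ (k + 1) * y / 2 = 2 ^ k * y := fun y => by rw [pow_succ]; ring
  rw [e, e, pow_succ, mul_comm ((2 : ℝ) ^ k) 2, mul_assoc]
  refine ⟨this.1, ?_⟩
  linarith [this.2]

theorem even_floor_total (k : ℕ) (z : Space 2) :
    Even ⌊2 ^ k * arrays.total (3 * k) z 1⌋ ↔ Even ⌊z 1⌋ := by
  induction k with
  | zero => simp [ShearSystem.total]
  | succ k ih => exact (arrays_level k z).1.trans ih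

/-- The plane is tiled by squares of side 2·2^{-k}. The sum of the two square indices, increased by
2, at most doubles when k grows by one, so in unscaled length the bound never increases. It forces
points ending beyond 32 to have labels far out. -/
theorem sum_total_lt (k : ℕ) (z : Space 2) :
    arrays.total (3 * k) z 0 + arrays.total (3 * k) z 1 <
      2 * ((⌊z 0 / 2⌋ + ⌊z 1 / 2⌋ + 2 : ℤ) : ℝ) := by
  have h : ⌊2 ^ k * arrays.total (3 * k) z 0 / 2⌋ + ⌊2 ^ k * arrays.total (3 * k) z 1 / 2⌋ + 2 ≤
      2 ^ k * (⌊z 0 / 2⌋ + ⌊z 1 / 2⌋ + 2) := by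
    induction k with
    | zero => simp [ShearSystem.total]
    | succ k ih =>
      have := (arrays_level k z).2
      rw [pow_succ (2 : ℤ), mul_comm _ (2 : ℤ), mul_assoc]
      linarith
  have h' : (⌊2 ^ k * arrays.total (3 * k) z 0 / 2⌋ : ℝ) +
      ⌊2 ^ k * arrays.total (3 * k) z 1 / 2⌋ + 2 ≤
      2 ^ k * ((⌊z 0 / 2⌋ + ⌊z 1 / 2⌋ + 2 : ℤ) : ℝ) := by exact_mod_cast h
  have h0 := Int.lt_floor_add_one (2 ^ k * arrays.total (3 * k) z 0 / 2)
  have h1 := Int.lt_floor_add_one (2 ^ k * arrays.total (3 * k) z 1 / 2)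
  have hK : (0 : ℝ) < 2 ^ k := by positivity
  rw [← mul_lt_mul_iff_right₀ hK]
  linarith

/-! ### From labels to initial positions; oscillation behind the arrays -/

theorem onlyAt_zero {N : ℕ} {σ : ℝ} (hσ : σ ≤ -27) : arrays.OnlyAt N 0 σ := by
  refine ⟨fun l hl => by omega, fun l _ hl => ?_⟩
  have h1 : arrays.lo 1 ≤ arrays.lo l := arrays.lo_strictMono.monotone hl
  have h2 : arrays.lo 1 = -(25 + 1 / 2 + 1) / 2 ^ (1 / 3) := by
    change -(arrayTop 1 + arrayOffset 1 + 1) / 2 ^ (1 / 3) = _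
    norm_num [arrayTop, arrayOffset]
  norm_num at h2
  linarith

theorem pos_eq_shear_zero {N : ℕ} (hN : 0 < N) {σ : ℝ} (hσ : σ ≤ -27) (z : Space 2) :
    arrays.pos N σ z = z + arrays.shift 0 σ z • axisVector 1 := by
  rw [arrays.pos_eq_shear hN (onlyAt_zero hσ)]
  rfl

/-- For points that have gone through all the arrays and now lie in `x₁ + x₂ > 32`, the initial
position lies in the same stripe as the label. -/
theorem even_floor_place_zero {N : ℕ} (hN : 0 < N) {z : Space 2}
    (hz : 15 ≤ ⌊z 0 / 2⌋ + ⌊z 1 / 2⌋) :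
    Even ⌊arrays.place N 0 z 1⌋ ↔ Even ⌊z 1⌋ := by
  classical
  have hshift : ∀ σ, 0 ≤ arrays.shift 0 σ z := fun σ =>
    mul_nonneg (by norm_num [arrays, arrayAxis, shearRate]) (ramp_nonneg _ _ _)
  have hz' : (15 : ℝ) ≤ ⌊z 0 / 2⌋ + ⌊z 1 / 2⌋ := by exact_mod_cast hz
  have f0 := Int.floor_le (z 0 / 2)
  have f1 := Int.floor_le (z 1 / 2)
  set σ := arrays.param N z 0 with hσ
  -- The label has x₁ + x₂ ≥ 30, so σ = -27 is reached at time at least 3. The second window starts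
  -- only at -53/2, hence at time 0 only the first array can have acted.
  have hlt : σ < -27 := by
    rw [← (arrays.time_strictMono hN z).lt_iff_lt, hσ, arrays.time_param hN, ShearSystem.time,
      pos_eq_shear_zero hN le_rfl, sum_add_smul_axisVector]
    linarith [hshift (-27)]
  have hy : arrays.place N 0 z = z + arrays.shift 0 σ z • axisVector 1 :=
    pos_eq_shear_zero hN hlt.le z
  have hsum := arrays.sub_sum_place hN 0 z
  rw [← hσ, hy, sum_add_smul_axisVector] at hsum
  rw [hy, add_smul_axisVector_self]
  have hs : arrays.shift 0 σ z = 1 / 3 * ramp (-z 0 - (31 - ⌊z 0⌋))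
      (-z 0 - (31 - ⌊z 0⌋) + if Even ⌊z 0⌋ then 3 else 0) σ := by
    change shearRate (arrayAxis 0) * ramp (arrayEnter 0 (z (1 - arrayAxis 0)))
      (arrayEnter 0 (z (1 - arrayAxis 0)) + arrayExtent 0 (z (1 - arrayAxis 0))) σ = _
    rw [show arrayAxis 0 = 1 from rfl, sub_self]
    norm_num [shearRate, arrayEnter, arrayExtent, arrayTop, arrayIndex, arrayOffset, arrayLength]
  by_cases he : Even ⌊z 0⌋
  · rcases le_or_gt σ (-z 0 - (31 - ⌊z 0⌋)) with hc | hc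
    · rw [hs, ramp_of_le hc, mul_zero, add_zero]
    · obtain ⟨j, hj⟩ := even_iff_exists_two_mul.1 he
      have hj2 : ⌊z 0 / 2⌋ = j := by rw [floor_half]; omega
      have hj' : (⌊z 0⌋ : ℝ) = 2 * j := by exact_mod_cast hj
      rw [hj2] at hz'
      rw [hj'] at hc
      -- The hypothesis on the label bounds its height below by 30 - 2j, while having entered the
      -- rectangle bounds the displaced height above by 31 - 2j. Label and initial position thus
      -- share one unit stripe.
      have h30 : (30 : ℝ) - 2 * j ≤ z 1 := by linarith
      have hnn := hshift σ
      have e1 : ⌊z 1 + arrays.shift 0 σ z⌋ = 30 - 2 * j := by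
        rw [Int.floor_eq_iff]
        push_cast
        constructor <;> linarith
      have e2 : ⌊z 1⌋ = 30 - 2 * j := by
        rw [Int.floor_eq_iff]
        push_cast
        constructor <;> linarith
      rw [e1, e2]
  · rw [hs, if_neg he, add_zero, ramp, sub_self, max_eq_left (min_le_right _ _), mul_zero, add_zero]

/-- All windows lie in σ < 0, so behind them x is the total image of its label. Parity at scale
2^{-(n+1)} then recalls the label's stripe, which is the stripe of the initial position. -/
theorem angle_transported (β : ℝ) (n : ℕ) {t : ℝ} {x : Space 2} (h32 : 32 < x 0 + x 1)
    (ht : x 0 + x 1 < t) :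
    angle β 0 (arrays.place (3 * (n + 1)) 0 (arrays.label (3 * (n + 1)) t x)) =
      angle β (n + 1) x := by
  have hN : 0 < 3 * (n + 1) := by omega
  set z := arrays.label (3 * (n + 1)) t x with hz
  have hx : arrays.total (3 * (n + 1)) z = x := by
    rw [hz, ShearSystem.label, arrays.pos_eq_total, Equiv.apply_symm_apply]
    intro l _
    linarith [arrays_hi_neg l]
  have h1 := sum_total_lt (n + 1) z
  rw [hx] at h1
  have h2 : (16 : ℝ) < ((⌊z 0 / 2⌋ + ⌊z 1 / 2⌋ + 2 : ℤ) : ℝ) := by linarith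
  have h3 : 16 < ⌊z 0 / 2⌋ + ⌊z 1 / 2⌋ + 2 := by exact_mod_cast h2
  have h4 := even_floor_total (n + 1) z
  rw [hx] at h4
  rw [angle, angle, pow_zero, one_mul]
  exact if_congr ((even_floor_place_zero hN (by omega)).trans h4.symm) rfl rfl

theorem densityAt_behind (N : ℕ) {t : ℝ} {x : Space 2} (ht : x 0 + x 1 < t) :
    arrays.densityAt N t x = 3 := by
  have h : ∀ m, ¬ arrays.IsActive m (t - (x 0 + x 1)) x := fun m h => by
    have := h.2.trans (arrays.exit_le_hi m _)
    linarith [arrays_hi_neg m]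
  simp [ShearSystem.densityAt, ShearSystem.density, h]

/-! ### Lipschitz continuity of the flux; bounds and convergence of the data -/

theorem exists_lipschitzWith_ramp (c d : ℝ) : ∃ K, LipschitzWith K (ramp c d) :=
  ⟨_, ((LipschitzWith.id.sub (LipschitzWith.const c)).min_const (d - c)).const_max 0⟩

theorem exists_lipschitzWith_flux : ∃ K, LipschitzWith K flux := by
  have h : flux = fun r => (ramp 2 3 r - ramp 1 2 r) • axisVector 0 + max (r - 3) 0 • axisVector 1 := by
    funext r
    rcases le_total r 1 with h1 | h1
    · rw [ramp_of_le (by linarith), ramp_of_le h1, max_eq_right (by linarith)]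
      simp [flux, h1]
    rcases le_total r 2 with h2 | h2
    · rw [ramp_of_le h2, ramp_of_mem h1 h2, max_eq_right (by linarith)]
      rcases h1.eq_or_lt with rfl | h1
      · simp [flux]
      · ext i; fin_cases i <;> simp [flux, not_le.2 h1, h2]
    rcases le_total r 3 with h3 | h3
    · rw [ramp_of_mem h2 h3, ramp_of_ge (by norm_num) h2, max_eq_right (by linarith),
        flux_of_mem_two_three h2 h3]
      module
    · rw [ramp_of_ge (by norm_num) h3, ramp_of_ge (by norm_num) (by linarith),
        max_eq_left (by linarith), flux_of_three_le h3]
      module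
  have hs : ∀ (g : ℝ → ℝ) (v : Space 2), (∃ K, LipschitzWith K g) →
      ∃ K, LipschitzWith K fun r => g r • v := fun g v ⟨K, hK⟩ =>
    ⟨_, (ContinuousLinearMap.toSpanSingleton ℝ v).lipschitz.comp hK⟩
  obtain ⟨K₁, h₁⟩ := exists_lipschitzWith_ramp 2 3
  obtain ⟨K₂, h₂⟩ := exists_lipschitzWith_ramp 1 2
  obtain ⟨K₃, h₃⟩ := hs _ (axisVector 0) ⟨_, h₁.sub h₂⟩
  obtain ⟨K₄, h₄⟩ := hs _ (axisVector 1)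
    ⟨_, (LipschitzWith.id.sub (LipschitzWith.const 3)).max_const 0⟩
  exact ⟨K₃ + K₄, h ▸ h₃.add h₄⟩

theorem norm_unitVector (θ : ℝ) : ‖unitVector θ‖ = 1 := by
  rw [EuclideanSpace.norm_eq, Fin.sum_univ_two]
  simp [unitVector]

theorem measurable_unitVector_angle (β : ℝ) (j : ℕ) :
    Measurable fun x => unitVector (angle β j x) := by
  have h : Measurable fun x : Space 2 => ⌊(2 : ℝ) ^ j * x 1⌋ :=
    Int.measurable_floor.comp (by fun_prop)
  have h' : ∀ x : Space 2, unitVector (angle β j x) =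
      if Even ⌊(2 : ℝ) ^ j * x 1⌋ then unitVector β else unitVector (-β) := fun x => by
    unfold angle
    split_ifs <;> rfl
  simp only [h']
  exact Measurable.ite (h (MeasurableSet.of_discrete (s := {i : ℤ | Even i})))
    measurable_const measurable_const

theorem rho_mem (n : ℕ) (t : ℝ) (x : Space 2) : 2 ≤ rho n t x ∧ rho n t x ≤ 4 := by
  rw [rho_eq_densityAt]
  exact arrays.density_mem _ _ x

theorem norm_rho_smul (n : ℕ) (t : ℝ) (x : Space 2) (θ : ℝ) :
    ‖rho n t x • unitVector θ‖ = rho n t x := by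
  rw [norm_smul, norm_unitVector, mul_one, Real.norm_of_nonneg (by linarith [(rho_mem n t x).1])]

theorem measurable_initialDatum (β : ℝ) (n : ℕ) : Measurable (initialDatum β n) := by
  unfold initialDatum
  rw [rho_eq_densityAt]
  exact (arrays.measurable_densityAt _ 0).smul (measurable_unitVector_angle β 0)

theorem isAdmissibleDatum_initialDatum (β : ℝ) (n : ℕ) :
    IsAdmissibleDatum 2 4 (initialDatum β n) where
  aestronglyMeasurable := (measurable_initialDatum β n).aestronglyMeasurable
  pos := two_pos
  bounds := ae_of_all _ fun x => by
    rw [initialDatum, norm_rho_smul]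
    exact rho_mem n 0 x

/-- The windows accumulate only at σ = 0 from below: those from level k on start at or after
-32·2^{-k}. Consequently the data are eventually stationary at every point. -/
theorem exists_inactive (σ : ℝ) (x : Space 2) : ∃ M, ∀ m ≥ M, ¬ arrays.IsActive m σ x := by
  rcases le_or_gt 0 σ with h | h
  · exact ⟨0, fun m _ ha => by
      linarith [ha.2.trans (arrays.exit_le_hi m _), arrays_hi_neg m]⟩
  obtain ⟨k, hk⟩ := exists_pow_lt_of_lt_one (show 0 < -σ / 32 by linarith)
    (show (1 / 2 : ℝ) < 1 by norm_num)
  refine ⟨3 * k, fun m hm ha => ?_⟩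
  have h1 : arrays.lo (3 * k) = -32 * (1 / 2) ^ k := by
    change -(arrayTop (3 * k) + arrayOffset (3 * k) + 1) / 2 ^ (3 * k / 3) = _
    have e1 : 3 * k / 3 = k := by omega
    have e2 : 3 * k % 3 = 0 := by omega
    rw [e1, arrayTop, arrayOffset, e2, one_div, inv_pow]
    norm_num
    rw [neg_div, div_eq_mul_inv]
  have h2 := arrays.lo_strictMono.monotone hm
  have h3 := (arrays.lo_le_enter m _).trans_lt ha.1
  linarith

theorem density_eq_of_inactive {M N : ℕ} (hMN : M ≤ N) {σ : ℝ} {x : Space 2}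
    (h : ∀ m ≥ M, ¬ arrays.IsActive m σ x) : arrays.density N σ x = arrays.density M σ x := by
  classical
  have key : ∀ a, (∃ m < N, arrays.axis m = a ∧ arrays.IsActive m σ x) ↔
      ∃ m < M, arrays.axis m = a ∧ arrays.IsActive m σ x := fun a =>
    ⟨fun ⟨m, _, h1, h2⟩ => ⟨m, not_le.1 fun h' => h m h' h2, h1, h2⟩,
      fun ⟨m, hm, h'⟩ => ⟨m, hm.trans_le hMN, h'⟩⟩
  rw [ShearSystem.density, ShearSystem.density, if_congr (key 1) rfl rfl, if_congr (key 0) rfl rfl]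

theorem exists_limit_initialDatum (β : ℝ) : ∃ uLim : Space 2 → Space 2,
    IsAdmissibleDatum 2 4 uLim ∧ TendstoL1locOn univ (initialDatum β) uLim := by
  have h : ∀ x, ∃ M, ∀ n ≥ M, initialDatum β n x = initialDatum β M x := fun x => by
    obtain ⟨M, hM⟩ := exists_inactive (0 - (x 0 + x 1)) x
    refine ⟨M, fun n hn => ?_⟩
    simp only [initialDatum, rho_eq_densityAt, ShearSystem.densityAt]
    rw [density_eq_of_inactive (by omega : M ≤ 3 * (n + 1)) hM,
      density_eq_of_inactive (by omega : M ≤ 3 * (M + 1)) hM]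
  choose M hM using h
  set uLim : Space 2 → Space 2 := fun x => initialDatum β (M x) x with huLim
  have hev : ∀ x, ∀ᶠ n in atTop, initialDatum β n x = uLim x := fun x =>
    (eventually_ge_atTop (M x)).mono fun n hn => hM x n hn
  have hmeas : Measurable uLim :=
    measurable_of_tendsto_metrizable (measurable_initialDatum β)
      (tendsto_pi_nhds.2 fun x => tendsto_const_nhds.congr' ((hev x).mono fun n hn => hn.symm))
  have hbd : ∀ n x, 2 ≤ ‖initialDatum β n x‖ ∧ ‖initialDatum β n x‖ ≤ 4 := fun n x => by
    rw [initialDatum, norm_rho_smul]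
    exact rho_mem n 0 x
  refine ⟨uLim, ⟨hmeas.aestronglyMeasurable, two_pos, ae_of_all _ fun x => hbd _ x⟩, ?_⟩
  intro K _ hK
  have := tendsto_lintegral_of_dominated_convergence (μ := volume.restrict K)
    (F := fun n x => ‖initialDatum β n x - uLim x‖ₑ) (f := fun _ => 0) (fun _ => ENNReal.ofReal 8)
    (fun n => ((measurable_initialDatum β n).sub hmeas).enorm)
    (fun n => ae_of_all _ fun x => ?_) ?_ (ae_of_all _ fun x => ?_)
  · simpa using this
  · change ‖initialDatum β n x - uLim x‖ₑ ≤ ENNReal.ofReal 8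
    rw [← ofReal_norm]
    exact ENNReal.ofReal_le_ofReal ((norm_sub_le _ _).trans
      (by linarith [(hbd n x).2, (hbd (M x) x).2]))
  · rw [setLIntegral_const]
    exact ENNReal.mul_ne_top ENNReal.ofReal_ne_top hK.measure_lt_top.ne
  · exact tendsto_const_nhds.congr' ((hev x).mono fun n hn => by simp [hn])

/-! ### The transported solutions -/

/-- The weak solution obtained by transporting the angle along the flow of the arrays. -/
def transported (β : ℝ) (n : ℕ) (t : ℝ) (x : Space 2) : Space 2 :=
  rho n t x • unitVector (angle β 0
    (arrays.place (3 * (n + 1)) 0 (arrays.label (3 * (n + 1)) t x)))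

theorem velocity_rho (n : ℕ) : (fun t x => velocity (rho n t x)) = arrays.field (3 * (n + 1)) := by
  rw [rho_eq_densityAt]
  rfl

theorem isTransportSolution_transported (β : ℝ) (n : ℕ) :
    IsTransportSolution velocity (initialDatum β n) (rho n) (transported β n) where
  entropy := by
    have h : (fun x => ‖initialDatum β n x‖) = rho n 0 := funext fun x => norm_rho_smul n 0 x _
    rw [h, rho_eq_densityAt]
    exact arrays.isEntropySolution _
  transport := by
    refine ⟨_, _, (velocity_rho n) ▸ arrays.isFlow (by omega), fun t _ => ae_of_all _ fun x => ?_⟩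
    rw [initialDatum, norm_rho_smul, smul_smul (rho n 0 _)⁻¹, inv_mul_cancel₀, one_smul, transported]
    exact (two_pos.trans_le (rho_mem n 0 _).1).ne'

theorem measurable_transported (β : ℝ) (n : ℕ) :
    Measurable fun p : ℝ × Space 2 => transported β n p.1 p.2 := by
  unfold transported
  rw [rho_eq_densityAt]
  exact (arrays.measurable_density_time _).smul ((measurable_unitVector_angle β 0).comp
    ((arrays.measurable_place (by omega) 0).comp (arrays.measurable_label_uncurry _)))

theorem isWeakSolution_transported (β : ℝ) (n : ℕ) :
    IsWeakSolution velocity (initialDatum β n) (transported β n) where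
  bounded := ⟨(measurable_transported β n).aestronglyMeasurable, 4, ae_of_all _ fun p => by
    rw [transported, norm_rho_smul]
    exact (rho_mem n p.1 p.2).2⟩
  weak φ hφ := by
    have h := arrays.isWeakSolution_aux (N := 3 * (n + 1)) (by omega) hφ
      (measurable_unitVector_angle β 0) (M := 1) fun x => (norm_unitVector _).le
    rw [← velocity_rho, ← rho_eq_densityAt] at h
    simp only [transported, norm_rho_smul]
    exact h

theorem transported_behind (β : ℝ) (n : ℕ) {t : ℝ} {x : Space 2} (h32 : 32 < x 0 + x 1)
    (ht : x 0 + x 1 < t) : transported β n t x = (3 : ℝ) • unitVector (angle β (n + 1) x) := by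
  rw [transported, angle_transported β n h32 ht, rho_eq_densityAt, densityAt_behind _ ht]

/-! ### Absence of strong limits and ill-posedness -/

theorem even_floor_add_shift (j : ℕ) (y : ℝ) :
    (Even ⌊(2 : ℝ) ^ j * ((1 / 2) ^ j + y)⌋ ↔ ¬ Even ⌊(2 : ℝ) ^ j * y⌋) ∧
    (Even ⌊(2 : ℝ) ^ (j + 1) * ((1 / 2) ^ j + y)⌋ ↔ Even ⌊(2 : ℝ) ^ (j + 1) * y⌋) := by
  have h1 : (2 : ℝ) ^ j * (1 / 2) ^ j = 1 := by rw [← mul_pow]; norm_num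
  have e1 : (2 : ℝ) ^ j * ((1 / 2) ^ j + y) = 2 ^ j * y + 1 := by linear_combination h1
  have e2 : (2 : ℝ) ^ (j + 1) * ((1 / 2) ^ j + y) = 2 ^ (j + 1) * y + 2 := by
    rw [pow_succ]; linear_combination 2 * h1
  rw [e1, e2, Int.floor_add_one, Int.floor_add_ofNat]
  constructor
  · rw [Int.even_add_one]
  · simp [Int.even_iff]

/-- The function equal to `3 (cos β, sin β)` or `3 (cos β, -sin β)` according to the parity of
`⌊2 ^ j y⌋`. -/
def stripe (β : ℝ) (j : ℕ) (y : ℝ) : Space 2 :=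
  if Even ⌊(2 : ℝ) ^ j * y⌋ then (3 : ℝ) • unitVector β else (3 : ℝ) • unitVector (-β)

theorem stripe_eq (β : ℝ) (j : ℕ) (x : Space 2) :
    (3 : ℝ) • unitVector (angle β j x) = stripe β j (x 1) := by
  unfold angle stripe
  split_ifs <;> rfl

theorem measurable_stripe (β : ℝ) (j : ℕ) : Measurable (stripe β j) := by
  have h : Measurable fun y : ℝ => ⌊(2 : ℝ) ^ j * y⌋ := Int.measurable_floor.comp (by fun_prop)
  exact Measurable.ite (h (MeasurableSet.of_discrete (s := {i : ℤ | Even i})))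
    measurable_const measurable_const

theorem unitVector_ne_neg {β : ℝ} (hβ : β ∈ Ioo 0 (Real.pi / 2)) :
    (3 : ℝ) • unitVector β ≠ (3 : ℝ) • unitVector (-β) := by
  intro h
  have h1 := congrArg (fun v : Space 2 => v 1) h
  have h2 := Real.sin_pos_of_pos_of_lt_pi hβ.1 (by linarith [hβ.2, Real.pi_pos])
  simp [unitVector] at h1
  linarith

/-- A sequence which, in a region, oscillates between two fixed values in finer and finer stripes
has no limit in `L¹_loc`. -/
theorem not_hasL1locLimitOn_of_stripe {X : Type*} [NormedAddCommGroup X] [NormedSpace ℝ X]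
    [ProperSpace X] [MeasureSpace X] [BorelSpace X]
    [(volume : Measure X).IsAddHaarMeasure] {β : ℝ} (hβ : β ∈ Ioo 0 (Real.pi / 2))
    {ℓ : X →L[ℝ] ℝ} {e : X} (hℓ : ℓ e = 1) (he : ‖e‖ ≤ 1) {Ω : Set X} {c : X} {r : ℝ} (hr : 0 < r)
    (hΩ : Metric.closedBall c (2 * r) ⊆ Ω) {w : ℕ → X → Space 2}
    (hw : ∀ n, ∀ x ∈ Ω, w n x = stripe β (n + 1) (ℓ x)) : ¬ HasL1locLimitOn Ω w := by
  rintro ⟨h, hint, hlim⟩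
  set K := Metric.closedBall c (2 * r) with hK
  have hKc : IsCompact K := isCompact_closedBall c _
  have hKm : MeasurableSet K := hKc.measurableSet
  set C : ENNReal := ‖(3 : ℝ) • unitVector β - (3 : ℝ) • unitVector (-β)‖ₑ with hC
  have hC0 : C ≠ 0 := by
    rw [hC, Ne, enorm_eq_zero, sub_eq_zero]
    exact unitVector_ne_neg hβ
  have hs : ∀ n, Measurable fun x => stripe β (n + 1) (ℓ x) := fun n =>
    (measurable_stripe β _).comp ℓ.continuous.measurable
  have hT : Tendsto (fun n => ∫⁻ x in K, ‖stripe β (n + 1) (ℓ x) - h x‖ₑ) atTop (𝓝 0) := by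
    refine (hlim K hΩ hKc).congr fun n => setLIntegral_congr_fun hKm fun x hx => ?_
    simp only [hw n x (hΩ hx)]
  have hhm : AEStronglyMeasurable h (volume.restrict K) :=
    (hint.integrableOn_compact_subset hΩ hKc).aestronglyMeasurable
  -- On this set two consecutive stripe patterns differ by the fixed amount C, so L¹ convergence
  -- would force its measure in K to tend to 0.
  set D : ℕ → Set X := fun n => {x | ¬ (Even ⌊(2 : ℝ) ^ (n + 1) * ℓ x⌋ ↔
    Even ⌊(2 : ℝ) ^ (n + 2) * ℓ x⌋)} with hD
  have hnorm : ∀ n, ∀ x ∈ D n, C = ‖stripe β (n + 1) (ℓ x) - stripe β (n + 2) (ℓ x)‖ₑ := by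
    intro n x hx
    have hx' : ¬ (Even ⌊(2 : ℝ) ^ (n + 1) * ℓ x⌋ ↔ Even ⌊(2 : ℝ) ^ (n + 2) * ℓ x⌋) := hx
    unfold stripe
    by_cases h1 : Even ⌊(2 : ℝ) ^ (n + 1) * ℓ x⌋ <;>
      by_cases h2 : Even ⌊(2 : ℝ) ^ (n + 2) * ℓ x⌋
    · exact absurd (iff_of_true h1 h2) hx'
    · rw [if_pos h1, if_neg h2]
    · rw [if_neg h1, if_pos h2, hC, enorm_sub_rev]
    · exact absurd (iff_of_false h1 h2) hx'
  have hDm : ∀ n, MeasurableSet (D n) := fun n => by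
    have h : ∀ j, MeasurableSet {x | Even ⌊(2 : ℝ) ^ j * ℓ x⌋} := fun j =>
      (Int.measurable_floor.comp (ℓ.continuous.measurable.const_mul _))
        (MeasurableSet.of_discrete (s := {i : ℤ | Even i}))
    exact ((h _).iff (h _)).compl
  have hupper : ∀ n, C * volume (D n ∩ K) ≤ (∫⁻ x in K, ‖stripe β (n + 1) (ℓ x) - h x‖ₑ) +
      ∫⁻ x in K, ‖stripe β (n + 2) (ℓ x) - h x‖ₑ := by
    intro n
    have hm : AEMeasurable (fun x => ‖stripe β (n + 1) (ℓ x) - h x‖ₑ) (volume.restrict K) :=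
      ((hs n).aestronglyMeasurable.sub hhm).enorm
    rw [← lintegral_add_left' hm, ← setLIntegral_const]
    calc ∫⁻ _ in D n ∩ K, C
        ≤ ∫⁻ x in D n ∩ K, (‖stripe β (n + 1) (ℓ x) - h x‖ₑ + ‖stripe β (n + 2) (ℓ x) - h x‖ₑ) := by
          refine setLIntegral_mono' ((hDm n).inter hKm) fun x hx => ?_
          rw [hnorm n x hx.1, ← sub_sub_sub_cancel_right _ _ (h x)]
          exact enorm_sub_le
      _ ≤ _ := lintegral_mono_set inter_subset_right
  have hlower : ∀ᶠ n in atTop, volume (Metric.closedBall c r) ≤ 2 * volume (D n ∩ K) := by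
    have ht : Tendsto (fun n : ℕ => (1 / 2 : ℝ) ^ (n + 1)) atTop (𝓝 0) :=
      (tendsto_pow_atTop_nhds_zero_of_lt_one (by norm_num) (by norm_num)).comp
        (tendsto_add_atTop_nat 1)
    filter_upwards [ht.eventually_lt_const hr] with n hn
    set τ : ℝ := (1 / 2) ^ (n + 1) with hτ
    have hτ0 : 0 < τ := by positivity
    -- Translation by one stripe width flips the coarser parity and keeps the finer one. So each
    -- point of the small ball, or its translate, lies in `D n`; the doubled radius of K makes room
    -- for the translate.
    have hsub : Metric.closedBall c r ⊆ (D n ∩ K) ∪ (fun x => τ • e + x) ⁻¹' (D n ∩ K) := by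
      intro x hx
      by_cases hxD : x ∈ D n
      · exact Or.inl ⟨hxD, Metric.closedBall_subset_closedBall (by linarith) hx⟩
      · refine Or.inr ⟨?_, ?_⟩
        · have hx' : Even ⌊(2 : ℝ) ^ (n + 1) * ℓ x⌋ ↔ Even ⌊(2 : ℝ) ^ (n + 2) * ℓ x⌋ :=
            not_not.1 hxD
          change ¬ (_ ↔ _)
          rw [map_add, map_smul, hℓ, smul_eq_mul, mul_one, (even_floor_add_shift _ _).1,
            (even_floor_add_shift _ _).2, ← hx']
          tauto
        · rw [hK, mem_closedBall_iff_norm] at *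
          have : ‖τ • e‖ ≤ r := by
            rw [norm_smul, Real.norm_of_nonneg hτ0.le]
            exact (mul_le_of_le_one_right hτ0.le he).trans hn.le
          calc ‖τ • e + x - c‖ = ‖τ • e + (x - c)‖ := by rw [add_sub_assoc]
            _ ≤ _ := (norm_add_le _ _).trans (by linarith)
    refine (measure_mono hsub).trans ((measure_union_le _ _).trans ?_)
    rw [measure_preimage_add, two_mul]
  have hle : C * volume (Metric.closedBall c r) ≤ 0 := by
    have hT2 := ENNReal.Tendsto.const_mul (a := 2)
      (hT.add ((tendsto_add_atTop_iff_nat 1).2 hT)) (Or.inr (by simp))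
    rw [add_zero, mul_zero] at hT2
    refine ge_of_tendsto hT2 (hlower.mono fun n hn => ?_)
    calc C * volume (Metric.closedBall c r) ≤ C * (2 * volume (D n ∩ K)) := by gcongr
      _ = 2 * (C * volume (D n ∩ K)) := by ring
      _ ≤ _ := by gcongr; exact hupper n
  exact (ENNReal.mul_pos hC0 (Metric.measure_closedBall_pos volume c hr).ne').not_ge hle

theorem abs_sum_sub_le {x c : Space 2} {r : ℝ} (h : ‖x - c‖ ≤ r) :
    |x 0 + x 1 - (c 0 + c 1)| ≤ 2 * r := by
  have h0 := (PiLp.norm_apply_le (x - c) 0).trans h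
  have h1 := (PiLp.norm_apply_le (x - c) 1).trans h
  rw [PiLp.sub_apply, Real.norm_eq_abs, abs_le] at h0 h1
  rw [abs_le]
  constructor <;> linarith [h0.1, h0.2, h1.1, h1.2]

theorem not_hasL1locLimitOn_slice {β : ℝ} (hβ : β ∈ Ioo 0 (Real.pi / 2)) {t : ℝ} (ht : 32 < t) :
    ¬ HasL1locLimitOn {x : Space 2 | 32 < x 0 + x 1 ∧ x 0 + x 1 < t}
      (fun n => transported β n t) := by
  -- The centre has x₁ + x₂ midway between 32 and t; on the ball of radius (t - 32)/8 this sum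
  -- varies by at most (t - 32)/4.
  refine not_hasL1locLimitOn_of_stripe hβ (ℓ := EuclideanSpace.proj 1) (e := axisVector 1)
    (c := ((32 + t) / 2) • axisVector 0) (r := (t - 32) / 16) (by simp) (by simp) (by linarith)
    (fun x hx => ?_) (fun n x hx => ?_)
  · have := abs_sum_sub_le (mem_closedBall_iff_norm.1 hx)
    rw [abs_le] at this
    simp at this
    constructor <;> linarith [this.1, this.2]
  · rw [transported_behind β n hx.1 hx.2, stripe_eq]
    rfl

theorem not_hasL1locLimitOn_transported {β : ℝ} (hβ : β ∈ Ioo 0 (Real.pi / 2)) :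
    ¬ HasL1locLimitOn {p : ℝ × Space 2 | 32 < p.2 0 + p.2 1 ∧ p.2 0 + p.2 1 < p.1}
      (fun n p => transported β n p.1 p.2) := by
  have : (volume : Measure (ℝ × Space 2)).IsAddHaarMeasure := by
    rw [Measure.volume_eq_prod]
    infer_instance
  -- On the ball of radius 1/2 the sum x₁ + x₂ stays in [35, 37], and t ≥ 79/2.
  refine not_hasL1locLimitOn_of_stripe hβ
    (ℓ := (EuclideanSpace.proj 1).comp (ContinuousLinearMap.snd ℝ ℝ (Space 2)))
    (e := ((0 : ℝ), axisVector 1)) (c := ((40 : ℝ), (36 : ℝ) • axisVector 0)) (r := 1 / 4)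
    (by simp) (by simp [Prod.norm_def]) (by norm_num) (fun p hp => ?_) (fun n p hp => ?_)
  · have hp' := mem_closedBall_iff_norm.1 hp
    have h1 := (norm_fst_le _).trans hp'
    have h2 := abs_sum_sub_le ((norm_snd_le _).trans hp')
    rw [Prod.fst_sub, Real.norm_eq_abs, abs_le] at h1
    rw [abs_le] at h2
    simp at h1 h2
    constructor <;> linarith [h1.1, h1.2, h2.1, h2.2]
  · rw [transported_behind β n hp.1 hp.2, stripe_eq]
    rfl

/-- The image under S of the limit datum would be an L¹_loc limit of the oscillating solutions. Any
admissible angle serves; here it is 1. -/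
theorem not_isWellPosed : ¬ IsWellPosed 2 velocity := by
  rintro ⟨S, hloc, hS, hcont⟩
  have hβ : (1 : ℝ) ∈ Ioo 0 (Real.pi / 2) := ⟨one_pos, by linarith [Real.pi_gt_three]⟩
  obtain ⟨uLim, hadm, hlim⟩ := exists_limit_initialDatum 1
  have hsub : {p : ℝ × Space 2 | 32 < p.2 0 + p.2 1 ∧ p.2 0 + p.2 1 < p.1} ⊆ Ioi 0 ×ˢ univ :=
    fun p hp => ⟨by rw [mem_Ioi]; linarith [hp.1, hp.2], trivial⟩
  refine not_hasL1locLimitOn_transported hβ ⟨S uLim, (hloc 2 4 uLim hadm).mono_set hsub, ?_⟩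
  intro K hK hKc
  refine (hcont 2 4 _ uLim (isAdmissibleDatum_initialDatum 1) hadm hlim K (hK.trans hsub) hKc).congr
    fun n => lintegral_congr_ae ?_
  have h := hS 2 4 _ _ _ (isAdmissibleDatum_initialDatum 1 n) (isTransportSolution_transported 1 n)
    (isWeakSolution_transported 1 n)
  filter_upwards [ae_restrict_of_ae_restrict_of_subset (hK.trans hsub) h] with p hp
  rw [hp]

end

theorem mainTheorem1 (β : ℝ) (hβ : β ∈ Set.Ioo 0 (Real.pi / 2)) :
    -- the flux is Lipschitz continuous, and `F(ρ) = f(ρ) ρ`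
    (∃ K, LipschitzWith K flux) ∧ (∀ r : ℝ, flux r = r • velocity r) ∧
    -- the data are uniformly bounded and bounded away from zero, and converge in `L¹_loc`
    (∀ n, IsAdmissibleDatum 2 4 (initialDatum β n)) ∧
    (∃ uLim : Space 2 → Space 2, IsAdmissibleDatum 2 4 uLim ∧
      TendstoL1locOn Set.univ (initialDatum β) uLim) ∧
    -- the weak solutions obtained by transporting the angle
    (∃ u : ℕ → ℝ → Space 2 → Space 2,
      (∀ n, IsTransportSolution velocity (initialDatum β n) (rho n) (u n)) ∧
      (∀ n, IsWeakSolution velocity (initialDatum β n) (u n)) ∧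
      -- oscillation of the angle in the region `32 < x₁ + x₂ < t`
      (∀ n, ∀ t : ℝ, 0 ≤ t → ∀ᵐ x : Space 2, 32 < x 0 + x 1 → x 0 + x 1 < t →
        u n t x = (3 : ℝ) • unitVector (angle β (n + 1) x)) ∧
      -- no strong limit at any time `t > 32`
      (∀ t : ℝ, 32 < t →
        ¬ HasL1locLimitOn {x : Space 2 | 32 < x 0 + x 1 ∧ x 0 + x 1 < t} (fun n => u n t)) ∧
      -- no strong limit as functions of `(t, x)`
      ¬ HasL1locLimitOn
          {p : ℝ × Space 2 | 32 < p.2 0 + p.2 1 ∧ p.2 0 + p.2 1 < p.1}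
          (fun n p => u n p.1 p.2)) ∧
    -- the Cauchy problem is ill posed
    ¬ IsWellPosed 2 velocity := by
  refine ⟨exists_lipschitzWith_flux, fun r => (smul_velocity r).symm,
    isAdmissibleDatum_initialDatum β, exists_limit_initialDatum β,
    ⟨transported β, isTransportSolution_transported β, isWeakSolution_transported β,
      fun n t _ => ae_of_all _ fun x h1 h2 => transported_behind β n h1 h2,
      fun t ht => not_hasL1locLimitOn_slice hβ ht, not_hasL1locLimitOn_transported hβ⟩,
    not_isWellPosed⟩
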